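/- **Setting.** A single item is for sale to $n$ buyers. A distribution $F$ on $[0,\infty)$ is *regular* if, for some $0\le a\le b\le\infty$, it has a positive density $f$ on $(a,b)$, all its remaining mass (if any) is an atom at the upper end point $b$, and the virtual value $x-\frac{1-F(x)}{f(x)}$ is non-decreasing on $(a,b)$ (point masses, $a=b$, are thus regular). Let $\mathcal A^R$ be the class of all regular distributions on $[0,\infty)$, and for a distribution $F$ let $v_F(q)=F^{-1}(1-q)$ be its quantile function. A *distribution-reporting mechanism* $M=(x,p)$ consists of (measurable) allocation rules $x_i(\cdot\,;\bm B):[0,\infty)^n\to[0,1]$ and payments $p_i(\bm B)\in\mathbb R$ for $i\in[n]$ and every profile of reported distributions $\bm B=(B_1,\dots,B_n)\in(\mathcal A^R)^n$. A buyer $i$ with true distribution $F_i$ has under the reports $\bm B$ the ex-ante utility $$U_i(\bm B;F_i)=\mathbb E_{q\sim U[0,1],\ \bm b_{-i}\sim \bm B_{-i}}\big[x_i(v_{B_i}(q),\bm b_{-i};\bm B)\,v_{F_i}(q)\big]-p_i(\bm B)\in(-\infty,+\infty].$$ $M$ is *valid* if it is ex-ante incentive compatible ($U_i(B_i,\bm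 B_{-i};F_i)\le U_i(F_i,\bm B_{-i};F_i)$ for all $i$, $F_i,B_i$, $\bm B_{-i}$), ex-ante individually rational ($U_i(\bm F;F_i)\ge 0$ for all $\bm F$ and $i$), and feasible ($\sum_i x_i(\bm b;\bm B)\le 1$ for all $\bm b,\bm B$). Put $\mathrm{REV}(M,\bm F)=\sum_i p_i(\bm F)$, and let $\mathrm{WEL}(\bm F)$ and $\mathrm{SPA}(\bm F)$ be the expected highest and the expected second-highest (with multiplicity) of independent values $v_i\sim F_i$, $i\in[n]$. **Theorem.** Let $n\ge 2$ be an integer and $K\ge 8$ a real number. For every valid distribution-reporting mechanism $M$ for the classes $\mathcal F_1=\dots=\mathcal F_n=\mathcal A^R$ there is an instance $\bm F=(F_1,\dots,F_n)\in(\mathcal A^R)^n$ with $\mathrm{SPA}(\bm F)>0$ and $\mathrm{WEL}(\bm F)<\infty$ such that $$\mathrm{REV}(M,\bm F)\le\min\left\{\frac{1382.4}{K+\log_2 n}\cdot\mathrm{WEL}(\bm F),\ 2^K\cdot\mathrm{SPA}(\bm F)\right\}.$$ -/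

import Mathlib

open MeasureTheory
open scoped NNReal ENNReal

noncomputable section

namespace DistReport

/-- A (value or bid) distribution on `[0, ∞)`. -/
abbrev Dist := ProbabilityMeasure ℝ≥0

/-- The distribution `F`, regarded as a measure on the real line. -/
def Dist.toRealMeasure (F : Dist) : Measure ℝ :=
  (F : Measure ℝ≥0).map ((↑) : ℝ≥0 → ℝ)

/-- The virtual value `x - (1 - F(x)) / f(x)`, where `F(x)` is the cumulative distribution function
and `f` is the density. -/
def virtualValue (F : Dist) (f : ℝ → ℝ) (x : ℝ) : ℝ :=
  x - (1 - ProbabilityTheory.cdf F.toRealMeasure x) / f x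

/-- Regularity: non-decreasing virtual value. `F` lives on an interval with end points `a ≤ b`
(`b = ∞` is allowed), has a positive density `f` on `(a, b)`, and all of its mass outside `(a, b)`
sits at `b`. An atom at the upper end point is therefore allowed (this covers point masses,
`a = b`, and truncated distributions). The virtual value at such an atom is `b` itself, which
exceeds every virtual value on `(a, b)`, so that monotonicity has to be required on `(a, b)` only. -/
def IsRegular (F : Dist) : Prop :=
  ∃ (a : ℝ) (b : EReal) (f : ℝ → ℝ),
    (a : EReal) ≤ b ∧
    Measurable f ∧
    (∀ x : ℝ, a < x → (x : EReal) < b → 0 < f x) ∧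
    F.toRealMeasure.restrict {x : ℝ | (x : EReal) < b} =
      (volume.restrict {x : ℝ | a < x ∧ (x : EReal) < b}).withDensity
        (fun x => ENNReal.ofReal (f x)) ∧
    F.toRealMeasure {x : ℝ | b < (x : EReal)} = 0 ∧
    MonotoneOn (virtualValue F f) {x : ℝ | a < x ∧ (x : EReal) < b}

/-- The class of all regular distributions on `[0, ∞)`. -/
def regularDists : Set Dist := {F | IsRegular F}

/-- The quantile function `v(q) = F⁻¹(1 - q)`. -/
def quantile (F : Dist) (q : ℝ) : ℝ≥0 :=
  sInf {x : ℝ≥0 | 1 - q ≤ ((F : Measure ℝ≥0) (Set.Iic x)).toReal}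

/-- Distribution profiles: one distribution from each class. -/
abbrev Profile {n : ℕ} (𝓕 : Fin n → Set Dist) := ∀ i : Fin n, 𝓕 i

/-- The joint law of independent draws from the members of a profile. -/
def Profile.law {n : ℕ} {𝓕 : Fin n → Set Dist} (B : Profile 𝓕) : Measure (Fin n → ℝ≥0) :=
  Measure.pi fun i => ((B i : Dist) : Measure ℝ≥0)

/-- A distribution-reporting mechanism for the distribution classes `𝓕`: the allocation
probabilities `x_i(b; B) ∈ [0, 1]`, measurable in the bids, and the payments `p_i(B) ∈ ℝ`. -/
structure Mechanism {n : ℕ} (𝓕 : Fin n → Set Dist) where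
  alloc : Fin n → (Fin n → ℝ≥0) → Profile 𝓕 → ℝ≥0
  pay : Fin n → Profile 𝓕 → ℝ
  alloc_le_one : ∀ i b B, alloc i b B ≤ 1
  measurable_alloc : ∀ i B, Measurable fun b => alloc i b B

namespace Mechanism

variable {n : ℕ} {𝓕 : Fin n → Set Dist}

/-- Ex-ante utility `U_i(B; F_i)` of buyer `i` with true distribution `F_i` under the reports `B`:
`E[x_i(b_i(q), b_{-i}; B) v_i(q)] - p_i(B)` for `q` uniform on `[0, 1]` and independent
`b_{-i} ∼ B_{-i}`. The whole vector `b` is drawn from `B` here, but its `i`-th coordinate is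
overwritten by `b_i(q)`. The expectation is that of a non-negative quantity and may be `+∞`. -/
def utility (M : Mechanism 𝓕) (i : Fin n) (B : Profile 𝓕) (Fi : 𝓕 i) : EReal :=
  ((∫⁻ q in Set.Icc (0 : ℝ) 1, ∫⁻ b,
      (M.alloc i (Function.update b i (quantile (B i) q)) B : ℝ≥0∞) * (quantile Fi q : ℝ≥0∞)
        ∂B.law : ℝ≥0∞) : EReal) - ((M.pay i B : ℝ) : EReal)

/-- At most one item is allocated. -/
def Feasible (M : Mechanism 𝓕) : Prop :=
  ∀ (b : Fin n → ℝ≥0) (B : Profile 𝓕), ∑ i, M.alloc i b B ≤ 1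

/-- Ex-ante incentive compatibility: whatever the others report, truth-telling is optimal. -/
def ExAnteIC (M : Mechanism 𝓕) : Prop :=
  ∀ (i : Fin n) (Fi : 𝓕 i) (B : Profile 𝓕),
    M.utility i B Fi ≤ M.utility i (Function.update B i Fi) Fi

/-- Ex-ante individual rationality. -/
def ExAnteIR (M : Mechanism 𝓕) : Prop :=
  ∀ (F : Profile 𝓕) (i : Fin n), 0 ≤ M.utility i F (F i)

/-- Valid mechanisms. -/
def Valid (M : Mechanism 𝓕) : Prop :=
  M.ExAnteIC ∧ M.ExAnteIR ∧ M.Feasible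

/-- Expected revenue under truthful reports. -/
def rev (M : Mechanism 𝓕) (F : Profile 𝓕) : ℝ :=
  ∑ i, M.pay i F

end Mechanism

/-- The highest coordinate. -/
def maxVal {n : ℕ} (v : Fin n → ℝ≥0) : ℝ≥0 :=
  Finset.univ.sup v

/-- The second-highest coordinate, counted with multiplicity: the largest `t` such that two
different coordinates are at least `t`. -/
def secMax {n : ℕ} (v : Fin n → ℝ≥0) : ℝ≥0 :=
  (Finset.univ : Finset (Fin n)).offDiag.sup fun p => min (v p.1) (v p.2)

/-- Optimal social welfare: the expected highest value. -/
def WEL {n : ℕ} {𝓕 : Fin n → Set Dist} (F : Profile 𝓕) : ℝ≥0∞ :=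
  ∫⁻ v, (maxVal v : ℝ≥0∞) ∂F.law

/-- Second-price revenue: the expected second-highest value. -/
def SPA {n : ℕ} {𝓕 : Fin n → Set Dist} (F : Profile 𝓕) : ℝ≥0∞ :=
  ∫⁻ v, (secMax v : ℝ≥0∞) ∂F.law

end DistReport

end

noncomputable section

namespace DistReport

/-! ### Regular distributions -/

/-! Let one buyer's law be a fixed law scaled by an unknown `2 ^ k`, with the other reports held
fixed. Utility is linear in the scale, so incentive compatibility bounds each payment increment by
`2 ^ (k + 1)` times an increment of the allocated unscaled value. Averaging over the discrete
equal-revenue prior makes these increments telescope: the expected payment is at most the mean of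
the unscaled law, however many scales are used (`Mechanism.erMean_pay_le`). Expected welfare does
grow with the number of scales. In both regimes the negated claim, averaged over the prior,
contradicts this gap.

If `log₂ n ≤ 344 K`, one point mass at `2 ^ k` and one at `1` suffice, the other values being `0`.
About `K` scales fit before `2 ^ K * SPA` could bind; revenue averages at most `2` and welfare at
least `K / 2`.

Otherwise all buyers but two get heavy-tailed laws with survival function `1 / (1 + n x / 2 ^ k)`,
truncated at `2 ^ k`, with independent scales up to `n`. Each unscaled mean is about `log n / n`, so
revenue averages `O(log n)`. The random scales contribute a second logarithm to the welfare, which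
is of order `(log n) ^ 2` (`le_erAvg_sum_prod_isolatedMean`). Two guard buyers with point masses of
order `log n` force a large second price at a cost of `O(log n)`. The minimum of the two benchmarks
is averaged through `min x C ≥ x - x ^ 2 / (4 C)` and the second-moment bound
`erAvg_sq_sum_two_pow_le`. -/

instance (F : Dist) : IsProbabilityMeasure F.toRealMeasure :=
  Measure.isProbabilityMeasure_map measurable_coe_nnreal_real.aemeasurable

/-- The point mass at `s`. -/
def pointDist (s : ℝ≥0) : Dist := ⟨Measure.dirac s, inferInstance⟩

lemma coe_pointDist (s : ℝ≥0) : (pointDist s : Measure ℝ≥0) = Measure.dirac s := rfl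

lemma toRealMeasure_pointDist (s : ℝ≥0) :
    (pointDist s).toRealMeasure = Measure.dirac (s : ℝ) := by
  rw [Dist.toRealMeasure, coe_pointDist, Measure.map_dirac' measurable_coe_nnreal_real]

lemma isRegular_pointDist (s : ℝ≥0) : IsRegular (pointDist s) := by
  have hempty : {x : ℝ | (s : ℝ) < x ∧ (x : EReal) < ((s : ℝ) : EReal)} = ∅ := by
    ext x
    simp only [EReal.coe_lt_coe_iff, Set.mem_ofPred_eq, Set.mem_empty_iff_false, iff_false]
    exact fun h => lt_asymm h.1 h.2
  refine ⟨s, ((s : ℝ) : EReal), fun _ => 1, le_rfl, measurable_const, fun _ _ _ => one_pos,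
    ?_, ?_, ?_⟩
  · rw [hempty, Measure.restrict_empty, withDensity_zero_left, Measure.restrict_eq_zero,
      toRealMeasure_pointDist]
    simp only [EReal.coe_lt_coe_iff]
    change Measure.dirac (s : ℝ) (Set.Iio (s : ℝ)) = 0
    rw [Measure.dirac_apply' _ measurableSet_Iio]
    simp
  · rw [toRealMeasure_pointDist]
    simp only [EReal.coe_lt_coe_iff]
    change Measure.dirac (s : ℝ) (Set.Ioi (s : ℝ)) = 0
    rw [Measure.dirac_apply' _ measurableSet_Ioi]
    simp
  · rw [hempty]
    exact fun x hx => absurd hx (Set.notMem_empty x)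

lemma quantile_pointDist (s : ℝ≥0) {q : ℝ} (hq0 : 0 ≤ q) (hq : q < 1) :
    quantile (pointDist s) q = s := by
  have : {x : ℝ≥0 | 1 - q ≤ ((pointDist s : Measure ℝ≥0) (Set.Iic x)).toReal} = Set.Ici s := by
    ext x
    rw [coe_pointDist, Set.mem_ofPred_eq, Measure.dirac_apply' _ measurableSet_Iic, Set.mem_Ici]
    by_cases h : s ≤ x
    · simp [h, hq0]
    · simp [h, hq]
  rw [quantile, this, csInf_Ici]

/-- The quantile function `q ↦ min 1 ((1/q - 1)/c)`; its law has survival function `1/(1+cx)` on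
`[0, 1)` and an atom at `1`. -/
def tailQuantile (c q : ℝ) : ℝ≥0 := min 1 (Real.toNNReal ((1 / q - 1) / c))

lemma measurable_tailQuantile (c : ℝ) : Measurable (tailQuantile c) := by
  unfold tailQuantile
  fun_prop

lemma tailQuantile_le_one (c q : ℝ) : tailQuantile c q ≤ 1 := min_le_left _ _

lemma tailQuantile_le_iff {c q : ℝ} (hc : 0 < c) (hq : 0 < q) {x : ℝ≥0} (hx : x < 1) :
    tailQuantile c q ≤ x ↔ 1 / (1 + c * x) ≤ q := by
  have h1 : 0 < 1 + c * (x : ℝ) := by positivity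
  rw [tailQuantile, min_le_iff, or_iff_right (not_le.2 hx), Real.toNNReal_le_iff_le_coe,
    div_le_iff₀ hc, div_le_iff₀ h1, sub_le_iff_le_add, div_le_iff₀ hq]
  constructor <;> intro h <;> linarith

lemma tailQuantile_lt_one_iff {c q : ℝ} (hc : 0 < c) (hq : 0 < q) :
    tailQuantile c q < 1 ↔ 1 / (1 + c) < q := by
  have h1 : 0 < 1 + c := by positivity
  rw [tailQuantile, min_lt_iff, or_iff_right (lt_irrefl _), Real.toNNReal_lt_one,
    div_lt_iff₀ hc, div_lt_iff₀ h1, sub_lt_iff_lt_add, div_lt_iff₀ hq]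
  constructor <;> intro h <;> linarith

/-- The law of `t * tailQuantile c q` for `q` uniform on `(0, 1]`. -/
def tailDist (c : ℝ) (t : ℝ≥0) : Dist :=
  ⟨(volume.restrict (Set.Ioc (0 : ℝ) 1)).map fun q => t * tailQuantile c q, by
    have : IsProbabilityMeasure (volume.restrict (Set.Ioc (0 : ℝ) 1)) := ⟨by simp⟩
    exact Measure.isProbabilityMeasure_map
      ((measurable_tailQuantile c).const_mul t).aemeasurable⟩

lemma coe_tailDist (c : ℝ) (t : ℝ≥0) : (tailDist c t : Measure ℝ≥0) =
    (volume.restrict (Set.Ioc (0 : ℝ) 1)).map fun q => t * tailQuantile c q := rfl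

lemma tailDist_apply (c : ℝ) (t : ℝ≥0) {s : Set ℝ≥0} (hs : MeasurableSet s) :
    (tailDist c t : Measure ℝ≥0) s = volume {q : ℝ | q ∈ Set.Ioc 0 1 ∧ t * tailQuantile c q ∈ s} := by
  rw [coe_tailDist, Measure.map_apply ((measurable_tailQuantile c).const_mul t) hs,
    Measure.restrict_apply (((measurable_tailQuantile c).const_mul t) hs)]
  congr 1
  ext q
  simp [and_comm]

lemma lintegral_tailDist (c : ℝ) (t : ℝ≥0) {g : ℝ≥0 → ℝ≥0∞} (hg : Measurable g) :
    ∫⁻ x, g x ∂(tailDist c t : Measure ℝ≥0) =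
      ∫⁻ q in Set.Ioc (0 : ℝ) 1, g (t * tailQuantile c q) := by
  rw [coe_tailDist, lintegral_map hg ((measurable_tailQuantile c).const_mul t)]

lemma mul_tailQuantile_le_iff {c q : ℝ} {t x : ℝ≥0} (hc : 0 < c) (hq : 0 < q) (hx : x < t) :
    t * tailQuantile c q ≤ x ↔ 1 / (1 + c / t * x) ≤ q := by
  have ht : 0 < t := pos_of_gt hx
  rw [mul_comm, ← le_div_iff₀ ht, tailQuantile_le_iff hc hq ((div_lt_one ht).2 hx)]
  congr! 3
  push_cast
  ring

lemma tailDist_Iic_of_lt {c : ℝ} {t x : ℝ≥0} (hc : 0 < c) (hx : x < t) :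
    (tailDist c t : Measure ℝ≥0) (Set.Iic x) = ENNReal.ofReal (1 - 1 / (1 + c / t * x)) := by
  have h1 : 0 < 1 / (1 + c / t * (x : ℝ)) := by positivity
  rw [tailDist_apply _ _ measurableSet_Iic, ← Real.volume_Icc]
  congr 1
  ext q
  simp only [Set.mem_Ioc, Set.mem_Iic, Set.mem_ofPred_eq, Set.mem_Icc]
  constructor
  · rintro ⟨⟨h0, h2⟩, h3⟩
    exact ⟨(mul_tailQuantile_le_iff hc h0 hx).1 h3, h2⟩
  · rintro ⟨h3, h2⟩
    have h0 := h1.trans_le h3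
    exact ⟨⟨h0, h2⟩, (mul_tailQuantile_le_iff hc h0 hx).2 h3⟩

lemma tailDist_Iic_of_le {c : ℝ} {t x : ℝ≥0} (hx : t ≤ x) :
    (tailDist c t : Measure ℝ≥0) (Set.Iic x) = 1 := by
  rw [tailDist_apply _ _ measurableSet_Iic]
  have : {q : ℝ | q ∈ Set.Ioc 0 1 ∧ t * tailQuantile c q ∈ Set.Iic x} = Set.Ioc 0 1 := by
    ext q
    simp only [Set.mem_Iic, Set.mem_ofPred_eq, and_iff_left_iff_imp]
    intro _
    exact (mul_le_of_le_one_right' (tailQuantile_le_one c q)).trans hx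
  rw [this]
  simp

lemma tailDist_Iio {c : ℝ} {t : ℝ≥0} (hc : 0 < c) (ht : 0 < t) :
    (tailDist c t : Measure ℝ≥0) (Set.Iio t) = ENNReal.ofReal (1 - 1 / (1 + c)) := by
  have h1 : 0 < 1 / (1 + c) := by positivity
  rw [tailDist_apply _ _ measurableSet_Iio, ← Real.volume_Ioc]
  congr 1
  ext q
  simp only [Set.mem_Ioc, Set.mem_Iio, Set.mem_ofPred_eq, mul_lt_iff_lt_one_right ht]
  constructor
  · rintro ⟨⟨h0, h2⟩, h3⟩
    exact ⟨(tailQuantile_lt_one_iff hc h0).1 h3, h2⟩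
  · rintro ⟨h3, h2⟩
    have h0 := h1.trans h3
    exact ⟨⟨h0, h2⟩, (tailQuantile_lt_one_iff hc h0).2 h3⟩

lemma quantile_tailDist {c q : ℝ} {t : ℝ≥0} (hc : 0 < c) (hq : 0 < q) :
    quantile (tailDist c t) q = t * tailQuantile c q := by
  have : {x : ℝ≥0 | 1 - q ≤ ((tailDist c t : Measure ℝ≥0) (Set.Iic x)).toReal} =
      Set.Ici (t * tailQuantile c q) := by
    ext x
    simp only [Set.mem_ofPred_eq, Set.mem_Ici]
    rcases lt_or_ge x t with hx | hx
    · have h1 : 1 / (1 + c / t * (x : ℝ)) ≤ 1 := by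
        rw [div_le_one (by positivity), le_add_iff_nonneg_right]
        positivity
      rw [tailDist_Iic_of_lt hc hx, mul_tailQuantile_le_iff hc hq hx,
        ENNReal.toReal_ofReal (by linarith)]
      constructor <;> intro h <;> linarith
    · rw [tailDist_Iic_of_le hx]
      simp [hq.le, (mul_le_of_le_one_right' (tailQuantile_le_one c q)).trans hx]
  rw [quantile, this, csInf_Ici]

lemma Dist.toRealMeasure_apply (F : Dist) {s : Set ℝ} (hs : MeasurableSet s) :
    F.toRealMeasure s = (F : Measure ℝ≥0) ((↑) ⁻¹' s) :=
  Measure.map_apply measurable_coe_nnreal_real hs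

lemma lintegral_tailDensity {κ y : ℝ} (hκ : 0 < κ) (hy : 0 ≤ y) :
    ∫⁻ x in Set.Ioc 0 y, ENNReal.ofReal (κ / (1 + κ * x) ^ 2) =
      ENNReal.ofReal (1 - 1 / (1 + κ * y)) := by
  have hpos : ∀ x ∈ Set.uIcc 0 y, 0 < 1 + κ * x := by
    intro x hx
    rw [Set.uIcc_of_le hy] at hx
    have := hx.1
    positivity
  have hcont : ContinuousOn (fun x => κ / (1 + κ * x) ^ 2) (Set.uIcc 0 y) := by
    refine ContinuousOn.div (by fun_prop) (by fun_prop) fun x hx => ?_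
    exact (pow_pos (hpos x hx) 2).ne'
  have hint := hcont.intervalIntegrable (μ := volume)
  have hderiv : ∀ x ∈ Set.uIcc 0 y,
      HasDerivAt (fun x => -(1 + κ * x)⁻¹) (κ / (1 + κ * x) ^ 2) x := by
    intro x hx
    have h1 : HasDerivAt (fun x => 1 + κ * x) κ x := by
      simpa using ((hasDerivAt_id x).const_mul κ).const_add 1
    exact (h1.inv (hpos x hx).ne').neg.congr_deriv (by rw [neg_div, neg_neg])
  rw [← ofReal_integral_eq_lintegral_ofReal, ← intervalIntegral.integral_of_le hy,
    intervalIntegral.integral_eq_sub_of_hasDerivAt hderiv hint]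
  · congr 1
    simp
    ring
  · exact (intervalIntegrable_iff_integrableOn_Ioc_of_le hy).1 hint
  · exact Filter.Eventually.of_forall fun x => by positivity

/-- With survival function `1 / (1 + κ x)` and density `κ / (1 + κ x) ^ 2`, where `κ = c / t`, the
virtual value is the constant `-1 / κ`: the borderline case of regularity. -/
lemma isRegular_tailDist {c : ℝ} {t : ℝ≥0} (hc : 0 < c) (ht : 0 < t) :
    IsRegular (tailDist c t) := by
  have htr : (0 : ℝ) < t := ht
  have hκ : 0 < c / (t : ℝ) := by positivity
  have hIic : ∀ x : ℝ, 0 ≤ x → x < t → (tailDist c t).toRealMeasure (Set.Iic x) =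
      ENNReal.ofReal (1 - 1 / (1 + c / t * x)) := by
    intro x hx hxt
    lift x to ℝ≥0 using hx
    rw [Dist.toRealMeasure_apply _ measurableSet_Iic, ← tailDist_Iic_of_lt hc (by exact_mod_cast hxt)]
    congr 1
  have hIio : (tailDist c t).toRealMeasure (Set.Iio (t : ℝ)) = ENNReal.ofReal (1 - 1 / (1 + c)) := by
    rw [Dist.toRealMeasure_apply _ measurableSet_Iio, ← tailDist_Iio hc ht]
    congr 1
  refine ⟨0, ((t : ℝ) : EReal), fun x => c / t / (1 + c / t * x) ^ 2, ?_, by fun_prop, ?_, ?_, ?_,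
    ?_⟩
  · exact_mod_cast htr.le
  · intro x hx _
    positivity
  · simp only [EReal.coe_lt_coe_iff]
    refine Measure.ext_of_Iic _ _ fun a => ?_
    have hset : {x : ℝ | 0 < x ∧ x < t} = Set.Ioo 0 (t : ℝ) := rfl
    have hset' : {x : ℝ | x < t} = Set.Iio (t : ℝ) := rfl
    rw [Measure.restrict_apply measurableSet_Iic, withDensity_apply _ measurableSet_Iic,
      Measure.restrict_restrict measurableSet_Iic, hset, hset']
    rcases lt_or_ge a 0 with ha | ha
    · have h1 : Set.Iic a ∩ Set.Ioo 0 (t : ℝ) = ∅ := by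
        ext x
        simp only [Set.mem_inter_iff, Set.mem_Iic, Set.mem_Ioo, Set.mem_empty_iff_false, iff_false]
        intro h
        linarith [h.1, h.2.1]
      rw [h1, Measure.restrict_empty, lintegral_zero_measure,
        Dist.toRealMeasure_apply _ (measurableSet_Iic.inter measurableSet_Iio)]
      have h2 : ((↑) : ℝ≥0 → ℝ) ⁻¹' (Set.Iic a ∩ Set.Iio (t : ℝ)) = ∅ := by
        ext x
        simp only [Set.mem_preimage, Set.mem_inter_iff, Set.mem_Iic, Set.mem_empty_iff_false,
          iff_false]
        intro h
        linarith [h.1, show (0 : ℝ) ≤ x from x.2]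
      rw [h2, measure_empty]
    rcases lt_or_ge a t with hat | hat
    · have h1 : Set.Iic a ∩ Set.Ioo 0 (t : ℝ) = Set.Ioc 0 a := by
        ext x
        simp only [Set.mem_inter_iff, Set.mem_Iic, Set.mem_Ioo, Set.mem_Ioc]
        exact ⟨fun h => ⟨h.2.1, h.1⟩, fun h => ⟨h.2, h.1, h.2.trans_lt hat⟩⟩
      rw [h1, lintegral_tailDensity hκ ha, ← hIic a ha hat,
        Set.inter_eq_left.2 (Set.Iic_subset_Iio.2 hat)]
    · have h1 : Set.Iic a ∩ Set.Ioo 0 (t : ℝ) = Set.Ioo 0 (t : ℝ) := by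
        refine Set.inter_eq_right.2 fun x hx => ?_
        exact hx.2.le.trans hat
      rw [h1, setLIntegral_congr Ioo_ae_eq_Ioc, lintegral_tailDensity hκ htr.le,
        Set.inter_eq_right.2 (show Set.Iio (t : ℝ) ⊆ Set.Iic a from
          fun x hx => (le_of_lt hx).trans hat), hIio,
        div_mul_cancel₀ _ htr.ne']
  · simp only [EReal.coe_lt_coe_iff]
    have hIic1 : (tailDist c t).toRealMeasure (Set.Iic (t : ℝ)) = 1 := by
      rw [Dist.toRealMeasure_apply _ measurableSet_Iic, ← tailDist_Iic_of_le (c := c) (le_refl t)]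
      congr 1
    have := prob_compl_eq_zero_iff (μ := (tailDist c t).toRealMeasure)
      (measurableSet_Iic (a := (t : ℝ)))
    rw [Set.compl_Iic] at this
    exact this.2 hIic1
  · have key : ∀ x : ℝ, 0 < x → x < t →
        virtualValue (tailDist c t) (fun x => c / t / (1 + c / t * x) ^ 2) x = -(1 / (c / t)) := by
      intro x hx hxt
      have h1 : 1 / (1 + c / t * x) ≤ 1 := by
        rw [div_le_one (by positivity), le_add_iff_nonneg_right]
        positivity
      rw [virtualValue, ProbabilityTheory.cdf_eq_real, measureReal_def, hIic x hx.le hxt,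
        ENNReal.toReal_ofReal (by linarith)]
      generalize c / (t : ℝ) = κ at *
      have : 0 < 1 + κ * x := by positivity
      field_simp
      ring
    intro x hx y hy _
    simp only [EReal.coe_lt_coe_iff, Set.mem_ofPred_eq] at hx hy
    rw [key x hx.1 hx.2, key y hy.1 hy.2]

/-! ### Moments of the heavy-tailed family -/

lemma lintegral_inv_sub_one {c Q : ℝ} (hc : 0 < c) (hQ : 1 / (1 + c) ≤ Q) (hQ1 : Q ≤ 1) :
    ∫⁻ q in Set.Ioc (1 / (1 + c)) Q, ENNReal.ofReal ((1 / q - 1) / c) =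
      ENNReal.ofReal ((Real.log (Q * (1 + c)) - (Q - 1 / (1 + c))) / c) := by
  have h0 : 0 < 1 / (1 + c) := by positivity
  have hpos : ∀ x ∈ Set.uIcc (1 / (1 + c)) Q, 0 < x := by
    intro x hx
    rw [Set.uIcc_of_le hQ] at hx
    exact h0.trans_le hx.1
  have hcont : ContinuousOn (fun q : ℝ => 1 / q) (Set.uIcc (1 / (1 + c)) Q) :=
    ContinuousOn.div (by fun_prop) (by fun_prop) fun x hx => (hpos x hx).ne'
  have hint := hcont.intervalIntegrable (μ := volume)
  have hint1 : IntervalIntegrable (fun _ : ℝ => (1 : ℝ)) volume (1 / (1 + c)) Q := by simp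
  have hval : ∫ q in (1 / (1 + c))..Q, (1 / q - 1) / c =
      (Real.log (Q * (1 + c)) - (Q - 1 / (1 + c))) / c := by
    rw [intervalIntegral.integral_div, intervalIntegral.integral_sub hint hint1,
      integral_one_div_of_pos h0 (h0.trans_le hQ)]
    simp
  rw [← hval, intervalIntegral.integral_of_le hQ, ofReal_integral_eq_lintegral_ofReal]
  · exact (intervalIntegrable_iff_integrableOn_Ioc_of_le hQ).1 ((hint.sub hint1).div_const c)
  · refine (ae_restrict_iff' measurableSet_Ioc).2 (Filter.Eventually.of_forall fun q hq => ?_)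
    have hq0 : 0 < q := h0.trans hq.1
    have : 1 ≤ 1 / q := by rw [le_div_iff₀ hq0]; linarith [hq.2]
    exact div_nonneg (by linarith) hc.le

/-- The mass `1 / (1 + c)` at the cap cancels the non-logarithmic part of the integral over the
remaining quantiles. -/
lemma lintegral_tailQuantile_le {c : ℝ} (hc : 0 < c) :
    ∫⁻ q in Set.Ioc (0 : ℝ) 1, (tailQuantile c q : ℝ≥0∞) ≤
      ENNReal.ofReal (Real.log (1 + c) / c) := by
  have h0 : 0 < 1 / (1 + c) := by positivity
  have h1 : 1 / (1 + c) ≤ 1 := by rw [div_le_one (by positivity)]; linarith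
  have hlog : 0 ≤ (Real.log (1 * (1 + c)) - (1 - 1 / (1 + c))) / c := by
    refine div_nonneg ?_ hc.le
    have := Real.one_sub_inv_le_log_of_pos (x := 1 + c) (by positivity)
    rw [one_mul, one_div]
    linarith
  rw [← Set.Ioc_union_Ioc_eq_Ioc h0.le h1]
  refine (lintegral_union_le _ _ _).trans ?_
  calc _ ≤ ENNReal.ofReal (1 / (1 + c)) +
        ENNReal.ofReal ((Real.log (1 * (1 + c)) - (1 - 1 / (1 + c))) / c) := by
        refine add_le_add ?_ ?_
        · calc _ ≤ ∫⁻ _ in Set.Ioc (0 : ℝ) (1 / (1 + c)), (1 : ℝ≥0∞) :=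
                lintegral_mono fun q => ENNReal.coe_le_one_iff.2 (tailQuantile_le_one c q)
            _ = _ := by simp
        · rw [← lintegral_inv_sub_one hc h1 le_rfl]
          refine lintegral_mono fun q => ?_
          exact ENNReal.coe_le_coe.2 (min_le_right _ _)
    _ = _ := by
        rw [← ENNReal.ofReal_add h0.le hlog]
        congr 1
        field_simp
        ring

lemma lintegral_tailDist_le {c : ℝ} (hc : 0 < c) (t : ℝ≥0) :
    ∫⁻ x, (x : ℝ≥0∞) ∂(tailDist c t : Measure ℝ≥0) ≤
      t * ENNReal.ofReal (Real.log (1 + c) / c) := by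
  rw [lintegral_tailDist c t measurable_coe_nnreal_ennreal]
  simp only [ENNReal.coe_mul]
  rw [lintegral_const_mul _ (measurable_tailQuantile c).coe_nnreal_ennreal]
  gcongr
  exact lintegral_tailQuantile_le hc

/-- Values in `(u, t)` come from quantiles between `1 / (1 + c)` and the survival probability `Q` at
`u`. The atom at `t` is discarded, and the `-1` absorbs the length of the quantile interval. -/
lemma le_lintegral_tailDist_indicator {c : ℝ} (hc : 0 < c) {t u : ℝ≥0} (hu : u < t) :
    t * ENNReal.ofReal ((Real.log ((1 + c) / (1 + c / t * u)) - 1) / c) ≤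
      ∫⁻ x, (Set.Ioi u).indicator (fun x : ℝ≥0 => (x : ℝ≥0∞)) x ∂(tailDist c t : Measure ℝ≥0) := by
  have ht : (0 : ℝ) < t := NNReal.coe_pos.2 (pos_of_gt hu)
  have h0 : 0 < 1 / (1 + c) := by positivity
  set Q : ℝ := 1 / (1 + c / t * u) with hQdef
  have hQ1 : Q ≤ 1 := by
    rw [hQdef, div_le_one (by positivity), le_add_iff_nonneg_right]
    positivity
  have hQ : 1 / (1 + c) ≤ Q := by
    refine one_div_le_one_div_of_le (by positivity) ?_
    have : (u : ℝ) / t ≤ 1 := (div_le_one ht).2 (by exact_mod_cast hu.le)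
    have h2 : c / t * u = c * (u / t) := by ring
    rw [h2]
    nlinarith
  rw [lintegral_tailDist c t (measurable_coe_nnreal_ennreal.indicator measurableSet_Ioi)]
  calc _ ≤ t * ENNReal.ofReal ((Real.log (Q * (1 + c)) - (Q - 1 / (1 + c))) / c) := by
        rw [hQdef, one_div_mul_eq_div, ← hQdef]
        gcongr
        linarith
    _ = ∫⁻ q in Set.Ioc (1 / (1 + c)) Q, t * ENNReal.ofReal ((1 / q - 1) / c) := by
        rw [← lintegral_inv_sub_one hc hQ hQ1, lintegral_const_mul]
        fun_prop
    -- The end point must go: at `q = Q` the value does not exceed `u`.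
    _ = ∫⁻ q in Set.Ioo (1 / (1 + c)) Q, t * ENNReal.ofReal ((1 / q - 1) / c) :=
        (setLIntegral_congr Ioo_ae_eq_Ioc).symm
    _ ≤ ∫⁻ q in Set.Ioo (1 / (1 + c)) Q,
          (Set.Ioi u).indicator (fun x : ℝ≥0 => (x : ℝ≥0∞)) (t * tailQuantile c q) := by
        refine setLIntegral_mono' measurableSet_Ioo fun q hq => ?_
        have hq0 : 0 < q := h0.trans hq.1
        have hmem : t * tailQuantile c q ∈ Set.Ioi u := by
          rw [Set.mem_Ioi, ← not_le, mul_tailQuantile_le_iff hc hq0 hu, not_le]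
          exact hq.2
        have hlt := (tailQuantile_lt_one_iff hc hq0).2 hq.1
        rw [Set.indicator_of_mem hmem, ENNReal.coe_mul, ENNReal.ofReal]
        gcongr
        rw [tailQuantile] at hlt ⊢
        rcases min_lt_iff.1 hlt with h | h
        · exact absurd h (lt_irrefl _)
        · rw [min_eq_right h.le]
    _ ≤ _ := lintegral_mono_set fun q (hq : q ∈ Set.Ioo _ _) =>
        show q ∈ Set.Ioc 0 1 from ⟨h0.trans hq.1, hq.2.le.trans hQ1⟩

/-! ### Discrete equal-revenue averages -/

/-- The expectation of `a` under the equal-revenue prior that gives the scale `2 ^ k` probability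
`2 ^ (-k - 1)` for `k < m` and `2 ^ (-m)` for `k = m`. -/
def erMean (m : ℕ) (a : ℕ → ℝ) : ℝ :=
  ∑ k ∈ Finset.range m, a k / 2 ^ (k + 1) + a m / 2 ^ m

lemma erMean_zero (a : ℕ → ℝ) : erMean 0 a = a 0 := by simp [erMean]

/-- Passing from `m` to `m + 1` moves half of the top atom one scale up; all inductions on `m` rest
on this. -/
lemma erMean_succ (m : ℕ) (a : ℕ → ℝ) :
    erMean (m + 1) a = erMean m a + (a (m + 1) - a m) / 2 ^ (m + 1) := by
  rw [erMean, erMean, Finset.sum_range_succ]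
  have : a m / 2 ^ m = 2 * (a m / 2 ^ (m + 1)) := by
    rw [pow_succ]
    field_simp
  rw [this]
  ring

lemma erMean_mono {m : ℕ} {a b : ℕ → ℝ} (h : ∀ k ≤ m, a k ≤ b k) : erMean m a ≤ erMean m b := by
  unfold erMean
  gcongr with k hk
  · exact h k (Finset.mem_range.1 hk).le
  · exact h m le_rfl

lemma erMean_const (m : ℕ) (x : ℝ) : erMean m (fun _ => x) = x := by
  induction m with
  | zero => exact erMean_zero _
  | succ m ih => rw [erMean_succ, ih]; simp

lemma erMean_add (m : ℕ) (a b : ℕ → ℝ) :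
    erMean m (fun k => a k + b k) = erMean m a + erMean m b := by
  simp only [erMean, add_div, Finset.sum_add_distrib]
  ring

lemma erMean_mul (m : ℕ) (x : ℝ) (a : ℕ → ℝ) :
    erMean m (fun k => x * a k) = x * erMean m a := by
  simp only [erMean, mul_add, Finset.mul_sum, mul_div_assoc]

lemma erMean_two_pow (m : ℕ) : erMean m (fun k => 2 ^ k) = m / 2 + 1 := by
  induction m with
  | zero => simp [erMean_zero]
  | succ m ih =>
    rw [erMean_succ, ih, pow_succ]
    push_cast
    field_simp
    ring

lemma erMean_four_pow_le (m : ℕ) : erMean m (fun k => 4 ^ k) ≤ 3 / 2 * 2 ^ m := by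
  have h : erMean m (fun k => 4 ^ k) = 3 / 2 * 2 ^ m - 1 / 2 := by
    induction m with
    | zero => norm_num [erMean_zero]
    | succ m ih =>
      rw [erMean_succ, ih, show (4 : ℝ) = 2 * 2 by norm_num, mul_pow, mul_pow, pow_succ]
      field_simp
      ring
  linarith

/-- Summation by parts for payments that satisfy the downward incentive constraints. -/
lemma erMean_le_of_increments {a A : ℕ → ℝ} (h0 : a 0 ≤ A 0)
    (h : ∀ k, a (k + 1) - a k ≤ 2 ^ (k + 1) * (A (k + 1) - A k)) (m : ℕ) : erMean m a ≤ A m := by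
  induction m with
  | zero => rwa [erMean_zero]
  | succ m ih =>
    have h1 : (a (m + 1) - a m) / 2 ^ (m + 1) ≤ A (m + 1) - A m := by
      rw [div_le_iff₀ (by positivity), mul_comm]
      exact h m
    rw [erMean_succ]
    linarith

/-! ### Payments of valid mechanisms -/

section Payments

variable {n : ℕ} {𝓕 : Fin n → Set Dist}

instance (B : Profile 𝓕) : IsProbabilityMeasure B.law := by
  unfold Profile.law
  infer_instance

/-- The expected value that buyer `i` obtains under the reports `B` if the quantile function of the
true distribution is `v`. -/
def Mechanism.allocValue (M : Mechanism 𝓕) (i : Fin n) (B : Profile 𝓕) (v : ℝ → ℝ≥0) : ℝ≥0∞ :=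
  ∫⁻ q in Set.Icc (0 : ℝ) 1, ∫⁻ b,
    (M.alloc i (Function.update b i (quantile (B i) q)) B : ℝ≥0∞) * (v q : ℝ≥0∞) ∂B.law

lemma Mechanism.allocValue_le (M : Mechanism 𝓕) (i : Fin n) (B : Profile 𝓕) (v : ℝ → ℝ≥0) :
    M.allocValue i B v ≤ ∫⁻ q in Set.Icc (0 : ℝ) 1, (v q : ℝ≥0∞) := by
  refine lintegral_mono fun q => ?_
  calc _ ≤ ∫⁻ _, (v q : ℝ≥0∞) ∂B.law := lintegral_mono fun b =>
        mul_le_of_le_one_left' (ENNReal.coe_le_one_iff.2 (M.alloc_le_one _ _ _))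
    _ = v q := by simp

/-- For a fixed report, utility is affine in the true scale `t`. Finiteness of the mean of `v` moves
everything to the reals; agreement almost everywhere leaves room for exceptional end points of the
quantile range. -/
lemma Mechanism.utility_eq (M : Mechanism 𝓕) (i : Fin n) (B : Profile 𝓕) (Fi : 𝓕 i) {t : ℝ≥0}
    {v : ℝ → ℝ≥0} (hF : ∀ᵐ q ∂volume.restrict (Set.Icc (0 : ℝ) 1), quantile Fi q = t * v q)
    (hv : ∫⁻ q in Set.Icc (0 : ℝ) 1, (v q : ℝ≥0∞) ≠ ⊤) :
    M.utility i B Fi = ((t * (M.allocValue i B v).toReal - M.pay i B : ℝ) : EReal) := by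
  have h1 : ∫⁻ q in Set.Icc (0 : ℝ) 1, ∫⁻ b,
      (M.alloc i (Function.update b i (quantile (B i) q)) B : ℝ≥0∞) * (quantile Fi q : ℝ≥0∞)
        ∂B.law = t * M.allocValue i B v := by
    rw [Mechanism.allocValue, ← lintegral_const_mul' _ _ ENNReal.coe_ne_top]
    refine lintegral_congr_ae ?_
    filter_upwards [hF] with q hq
    rw [← lintegral_const_mul' _ _ ENNReal.coe_ne_top]
    refine lintegral_congr fun b => ?_
    rw [hq, ENNReal.coe_mul]
    ring
  have h2 : M.allocValue i B v ≠ ⊤ := ne_top_of_le_ne_top hv (M.allocValue_le i B v)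
  rw [Mechanism.utility, h1]
  lift M.allocValue i B v to ℝ≥0 using h2 with A
  rw [← ENNReal.coe_mul]
  rfl

lemma Mechanism.pay_le (M : Mechanism 𝓕) (hM : M.ExAnteIR) (i : Fin n) (B : Profile 𝓕) {t : ℝ≥0}
    {v : ℝ → ℝ≥0} (hF : ∀ᵐ q ∂volume.restrict (Set.Icc (0 : ℝ) 1), quantile (B i) q = t * v q)
    (hv : ∫⁻ q in Set.Icc (0 : ℝ) 1, (v q : ℝ≥0∞) ≠ ⊤) :
    M.pay i B ≤ t * (M.allocValue i B v).toReal := by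
  have h := hM B i
  rw [M.utility_eq i B (B i) hF hv] at h
  have h' : (0 : ℝ) ≤ t * (M.allocValue i B v).toReal - M.pay i B := by exact_mod_cast h
  linarith

/-- This is the constraint that true type `H` does not gain by reporting `G`, so both allocated
values use the quantile shape `v` of `H`. -/
lemma Mechanism.pay_sub_le (M : Mechanism 𝓕) (hM : M.ExAnteIC) (i : Fin n) (B : Profile 𝓕)
    (G H : 𝓕 i) {t : ℝ≥0} {v : ℝ → ℝ≥0}
    (hH : ∀ᵐ q ∂volume.restrict (Set.Icc (0 : ℝ) 1), quantile H q = t * v q)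
    (hv : ∫⁻ q in Set.Icc (0 : ℝ) 1, (v q : ℝ≥0∞) ≠ ⊤) :
    M.pay i (Function.update B i H) - M.pay i (Function.update B i G) ≤
      t * ((M.allocValue i (Function.update B i H) v).toReal -
        (M.allocValue i (Function.update B i G) v).toReal) := by
  have h := hM i H (Function.update B i G)
  rw [Function.update_idem, M.utility_eq i _ H hH hv, M.utility_eq i _ H hH hv] at h
  have h' := EReal.coe_le_coe_iff.1 h
  linarith

/-- Individual rationality starts the telescoping at scale `1`, the downward constraints between
neighbouring scales continue it, and the allocation bound `1` caps the final allocated value by `μ`.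
-/
lemma Mechanism.erMean_pay_le (M : Mechanism 𝓕) (hM : M.Valid) (i : Fin n) (B : Profile 𝓕)
    (D : ℕ → 𝓕 i) {v : ℝ → ℝ≥0}
    (hD : ∀ k, ∀ᵐ q ∂volume.restrict (Set.Icc (0 : ℝ) 1), quantile (D k) q = 2 ^ k * v q)
    {μ : ℝ} (hμ : 0 ≤ μ) (hv : ∫⁻ q in Set.Icc (0 : ℝ) 1, (v q : ℝ≥0∞) ≤ ENNReal.ofReal μ)
    (m : ℕ) : erMean m (fun k => M.pay i (Function.update B i (D k))) ≤ μ := by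
  have hv' := ne_top_of_le_ne_top ENNReal.ofReal_ne_top hv
  refine (erMean_le_of_increments (A := fun k => (M.allocValue i (Function.update B i (D k))
    v).toReal) ?_ ?_ m).trans ?_
  · have := M.pay_le hM.2.1 i (Function.update B i (D 0)) (t := 2 ^ 0) (v := v)
      (by simpa using hD 0) hv'
    simpa using this
  · intro k
    have := M.pay_sub_le hM.1 i B (D k) (D (k + 1)) (hD (k + 1)) hv'
    push_cast at this
    exact this
  · exact ENNReal.toReal_le_of_le_ofReal hμ ((M.allocValue_le _ _ _).trans hv)

lemma Mechanism.pay_le_of_pointDist (M : Mechanism 𝓕) (hM : M.Valid) (i : Fin n) (B : Profile 𝓕)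
    {s : ℝ≥0} (hB : (B i : Dist) = pointDist s) : M.pay i B ≤ s := by
  have hv : ∫⁻ _ in Set.Icc (0 : ℝ) 1, ((1 : ℝ≥0) : ℝ≥0∞) = 1 := by simp
  refine (M.pay_le hM.2.1 i B (t := s) (v := fun _ => 1) ?_ (by rw [hv]; simp)).trans ?_
  -- At `q = 1` the quantile is the infimum of all of `ℝ≥0`, namely `0` rather than `s`.
  · rw [← restrict_Ico_eq_restrict_Icc]
    refine (ae_restrict_iff' measurableSet_Ico).2 (Filter.Eventually.of_forall fun q hq => ?_)
    rw [hB, quantile_pointDist s hq.1 hq.2, mul_one]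
  · have := M.allocValue_le i B (fun _ => 1)
    rw [hv] at this
    exact mul_le_of_le_one_right s.2 (ENNReal.toReal_le_of_le_ofReal zero_le_one (by simpa using this))

/-! ### Welfare and second-price revenue -/

lemma maxVal_le_sum (v : Fin n → ℝ≥0) : maxVal v ≤ ∑ i, v i :=
  Finset.sup_le fun i _ => Finset.single_le_sum_of_canonicallyOrdered (Finset.mem_univ i)

lemma le_maxVal (v : Fin n → ℝ≥0) (i : Fin n) : v i ≤ maxVal v :=
  Finset.le_sup (f := v) (Finset.mem_univ i)

lemma lintegral_eval_law (B : Profile 𝓕) (i : Fin n) {g : ℝ≥0 → ℝ≥0∞} (hg : Measurable g) :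
    ∫⁻ v, g (v i) ∂B.law = ∫⁻ x, g x ∂((B i : Dist) : Measure ℝ≥0) :=
  (measurePreserving_eval (fun i => ((B i : Dist) : Measure ℝ≥0)) i).lintegral_comp hg

lemma WEL_le_sum (B : Profile 𝓕) :
    WEL B ≤ ∑ i, ∫⁻ x, (x : ℝ≥0∞) ∂((B i : Dist) : Measure ℝ≥0) := by
  calc WEL B ≤ ∫⁻ v, ∑ i, (v i : ℝ≥0∞) ∂B.law := by
        refine lintegral_mono fun v => ?_
        rw [← ENNReal.ofNNReal_finsetSum]
        exact ENNReal.coe_le_coe.2 (maxVal_le_sum v)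
    _ = _ := by
        rw [lintegral_finsetSum _ fun i _ => by fun_prop]
        exact Finset.sum_congr rfl fun i _ =>
          lintegral_eval_law B i measurable_coe_nnreal_ennreal

lemma lintegral_le_WEL (B : Profile 𝓕) (i : Fin n) :
    ∫⁻ x, (x : ℝ≥0∞) ∂((B i : Dist) : Measure ℝ≥0) ≤ WEL B := by
  rw [← lintegral_eval_law B i measurable_coe_nnreal_ennreal]
  exact lintegral_mono fun v => ENNReal.coe_le_coe.2 (le_maxVal v i)

lemma SPA_le_WEL (B : Profile 𝓕) : SPA B ≤ WEL B :=
  lintegral_mono fun v => ENNReal.coe_le_coe.2 <|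
    Finset.sup_le fun p _ => (min_le_left _ _).trans (le_maxVal v p.1)

lemma le_SPA (B : Profile 𝓕) {i j : Fin n} (hij : i ≠ j) {s a b : ℝ≥0}
    (hi : (B i : Dist) = pointDist a) (hj : (B j : Dist) = pointDist b) (ha : s ≤ a) (hb : s ≤ b) :
    (s : ℝ≥0∞) ≤ SPA B := by
  have key : ∀ (i : Fin n) (a : ℝ≥0), (B i : Dist) = pointDist a → ∀ᵐ v ∂B.law, v i = a := by
    intro i a hi
    have hq := (measurePreserving_eval (fun i => ((B i : Dist) : Measure ℝ≥0)) i).quasiMeasurePreserving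
    have h : ∀ᵐ x ∂((B i : Dist) : Measure ℝ≥0), x = a := by
      rw [hi, coe_pointDist]
      exact (ae_dirac_iff (measurableSet_eq)).2 rfl
    exact hq.ae h
  calc (s : ℝ≥0∞) = ∫⁻ _, (s : ℝ≥0∞) ∂B.law := by simp
    _ ≤ SPA B := by
      refine lintegral_mono_ae ?_
      filter_upwards [key i a hi, key j b hj] with v h1 h2
      refine ENNReal.coe_le_coe.2 ?_
      refine le_trans ?_ (Finset.le_sup (f := fun p : Fin n × Fin n => min (v p.1) (v p.2))
        (b := (i, j)) (by simpa using hij))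
      simp [h1, h2, ha, hb]

lemma lintegral_pointDist (s : ℝ≥0) :
    ∫⁻ x, (x : ℝ≥0∞) ∂(pointDist s : Measure ℝ≥0) = s := by
  rw [coe_pointDist, lintegral_dirac' _ measurable_coe_nnreal_ennreal]

end Payments

/-! ### Few buyers: one point mass of unknown scale -/

lemma exists_instance_of_logb_le (n : ℕ) (hn : 2 ≤ n) (K : ℝ) (hK : 8 ≤ K)
    (M : Mechanism (fun _ : Fin n => regularDists)) (hM : M.Valid)
    (hlog : Real.logb 2 n ≤ 344 * K) :
    ∃ F : Profile (fun _ : Fin n => regularDists), 0 < SPA F ∧ WEL F < ⊤ ∧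
      M.rev F ≤ min (1382.4 / (K + Real.logb 2 n) * (WEL F).toReal)
        ((2 : ℝ) ^ K * (SPA F).toReal) := by
  set i₀ : Fin n := ⟨0, by omega⟩ with hi₀
  set i₁ : Fin n := ⟨1, by omega⟩ with hi₁
  have hne : i₁ ≠ i₀ := by simp [hi₀, hi₁]
  let D : ℕ → regularDists := fun k => ⟨pointDist (2 ^ k), isRegular_pointDist _⟩
  let B : Profile (fun _ : Fin n => regularDists) := fun i =>
    ⟨pointDist (if i = i₁ then 1 else 0), isRegular_pointDist _⟩
  let P : ℕ → Profile (fun _ : Fin n => regularDists) := fun k => Function.update B i₀ (D k)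
  have hP₀ : ∀ k, (P k i₀ : Dist) = pointDist (2 ^ k) := fun k => by simp [P, D]
  have hP : ∀ k i, i ≠ i₀ → (P k i : Dist) = pointDist (if i = i₁ then 1 else 0) :=
    fun k i hi => by simp [P, B, hi]
  have hWtop : ∀ k, WEL (P k) < ⊤ := by
    intro k
    refine (WEL_le_sum _).trans_lt (ENNReal.sum_lt_top.2 fun i _ => ?_)
    by_cases hi : i = i₀
    · rw [hi, hP₀, lintegral_pointDist]
      exact ENNReal.coe_lt_top
    · rw [hP k i hi, lintegral_pointDist]
      exact ENNReal.coe_lt_top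
  have hW : ∀ k, (2 : ℝ) ^ k ≤ (WEL (P k)).toReal := by
    intro k
    have h := lintegral_le_WEL (P k) i₀
    rw [hP₀, lintegral_pointDist] at h
    have := ENNReal.toReal_mono (hWtop k).ne h
    simpa using this
  have hS : ∀ k, (1 : ℝ≥0∞) ≤ SPA (P k) := by
    intro k
    have := le_SPA (P k) (s := 1) hne.symm (hP₀ k) (hP k i₁ hne) (one_le_pow₀ one_le_two)
      (by simp)
    simpa using this
  have hrev : ∀ k, M.rev (P k) ≤ M.pay i₀ (P k) + 1 := by
    intro k
    rw [Mechanism.rev, ← Finset.add_sum_erase _ _ (Finset.mem_univ i₀)]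
    gcongr
    calc _ ≤ ∑ i ∈ Finset.univ.erase i₀, if i = i₁ then (1 : ℝ) else 0 := by
          refine Finset.sum_le_sum fun i hi => ?_
          refine (M.pay_le_of_pointDist hM i _ (hP k i (Finset.ne_of_mem_erase hi))).trans ?_
          split_ifs <;> simp
      _ = 1 := by
          rw [Finset.sum_ite_eq']
          simp [hne]
  have hlog0 : 0 ≤ Real.logb 2 n := Real.logb_nonneg one_lt_two (by exact_mod_cast (by omega))
  have hc : 0 < 1382.4 / (K + Real.logb 2 n) := by
    have : 0 < K + Real.logb 2 n := by linarith
    positivity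
  by_contra! hcon
  have hfloor : 8 ≤ ⌊K⌋₊ := Nat.le_floor hK
  -- One exponent is kept in reserve: revenue is at most `2 ^ m + 1 ≤ 2 ^ (m + 1) ≤ 2 ^ K`, so only
  -- the welfare benchmark can be exceeded.
  obtain ⟨m, hm⟩ : ∃ m, ⌊K⌋₊ = m + 1 := ⟨⌊K⌋₊ - 1, by omega⟩
  have hlarge : ∀ k ≤ m, 1382.4 / (K + Real.logb 2 n) * 2 ^ k ≤ M.pay i₀ (P k) + 1 := by
    intro k hk
    have h1 := hcon (P k) (one_pos.trans_le (hS k)) (hWtop k)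
    have h2 : (1 : ℝ) ≤ (SPA (P k)).toReal := by
      have := ENNReal.toReal_mono ((SPA_le_WEL (P k)).trans_lt (hWtop k)).ne (hS k)
      simpa using this
    have h3 : M.rev (P k) ≤ (2 : ℝ) ^ K * (SPA (P k)).toReal := by
      have h4 := M.pay_le_of_pointDist hM i₀ _ (hP₀ k)
      have h5 : (2 : ℝ) ^ (m + 1) ≤ (2 : ℝ) ^ K := by
        rw [← Real.rpow_natCast]
        refine Real.rpow_le_rpow_of_exponent_le one_le_two ?_
        rw [← hm]
        exact Nat.floor_le (by linarith)
      have h6 : (2 : ℝ) ^ k ≤ 2 ^ m := pow_le_pow_right₀ one_le_two hk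
      have h7 : (1 : ℝ) ≤ 2 ^ m := one_le_pow₀ one_le_two
      have h8 := hrev k
      push_cast at h4
      rw [pow_succ] at h5
      nlinarith
    rcases min_lt_iff.1 h1 with h | h
    · refine le_trans ?_ (h.le.trans (hrev k))
      gcongr
      exact hW k
    · exact absurd h3 (not_le.2 h)
  have hle := erMean_mono hlarge
  rw [erMean_mul, erMean_two_pow, erMean_add, erMean_const] at hle
  have hpay := M.erMean_pay_le hM i₀ B D (v := fun _ => 1) (μ := 1) (fun k => by
      rw [← restrict_Ico_eq_restrict_Icc]
      refine (ae_restrict_iff' measurableSet_Ico).2 (Filter.Eventually.of_forall fun q hq => ?_)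
      rw [quantile_pointDist _ hq.1 hq.2, mul_one]) zero_le_one (by simp) m
  have hmK : K / 2 ≤ (m : ℝ) / 2 + 1 := by
    have := Nat.lt_floor_add_one K
    rw [hm] at this
    push_cast at this
    linarith
  -- This would give `1382.4 * K ≤ 4 * (K + log₂ n) ≤ 1380 * K`.
  have h1 : 1382.4 / (K + Real.logb 2 n) * (K / 2) ≤ 2 := by
    refine le_trans (mul_le_mul_of_nonneg_left hmK hc.le) ?_
    linarith
  rw [div_mul_eq_mul_div, div_le_iff₀ (by linarith)] at h1
  linarith

/-! ### Averages over independent scales -/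

/-- The weights of the equal-revenue prior. -/
def erWeight (m k : ℕ) : ℝ := if k < m then 1 / 2 ^ (k + 1) else 1 / 2 ^ m

lemma erWeight_nonneg (m k : ℕ) : 0 ≤ erWeight m k := by
  unfold erWeight
  split_ifs <;> positivity

lemma sum_erWeight_mul (m : ℕ) (a : ℕ → ℝ) :
    ∑ k ∈ Finset.range (m + 1), erWeight m k * a k = erMean m a := by
  rw [Finset.sum_range_succ, erMean]
  congr 1
  · refine Finset.sum_congr rfl fun k hk => ?_
    rw [erWeight, if_pos (Finset.mem_range.1 hk)]
    ring
  · rw [erWeight, if_neg (lt_irrefl m)]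
    ring

/-- The vectors of exponents at most `m`. -/
def scales (n m : ℕ) : Finset (Fin n → ℕ) := Fintype.piFinset fun _ => Finset.range (m + 1)

/-- The expectation of `f` under independent exponents with the equal-revenue prior. -/
def erAvg (n m : ℕ) (f : (Fin n → ℕ) → ℝ) : ℝ :=
  ∑ t ∈ scales n m, (∏ j, erWeight m (t j)) * f t

section Averages

variable {n m : ℕ}

lemma erAvg_mono {f g : (Fin n → ℕ) → ℝ} (h : ∀ t ∈ scales n m, f t ≤ g t) :
    erAvg n m f ≤ erAvg n m g :=
  Finset.sum_le_sum fun t ht =>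
    mul_le_mul_of_nonneg_left (h t ht) (Finset.prod_nonneg fun _ _ => erWeight_nonneg _ _)

lemma erAvg_sum {ι : Type*} (s : Finset ι) (f : ι → (Fin n → ℕ) → ℝ) :
    erAvg n m (fun t => ∑ i ∈ s, f i t) = ∑ i ∈ s, erAvg n m (f i) := by
  simp only [erAvg, Finset.mul_sum]
  exact Finset.sum_comm

lemma erAvg_sub (f g : (Fin n → ℕ) → ℝ) :
    erAvg n m (fun t => f t - g t) = erAvg n m f - erAvg n m g := by
  simp only [erAvg, mul_sub, Finset.sum_sub_distrib]

lemma erAvg_mul (x : ℝ) (f : (Fin n → ℕ) → ℝ) :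
    erAvg n m (fun t => x * f t) = x * erAvg n m f := by
  simp only [erAvg, Finset.mul_sum]
  exact Finset.sum_congr rfl fun t _ => by ring

lemma erAvg_prod (g : Fin n → ℕ → ℝ) :
    erAvg n m (fun t => ∏ j, g j (t j)) = ∏ j, erMean m (g j) := by
  simp only [erAvg, ← Finset.prod_mul_distrib, ← sum_erWeight_mul]
  rw [Finset.prod_univ_sum, scales]

lemma erAvg_const (x : ℝ) : erAvg n m (fun _ => x) = x := by
  have h := erAvg_prod (n := n) (m := m) fun _ _ => 1
  simp only [Finset.prod_const_one, erMean_const] at h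
  have h2 := erAvg_mul (n := n) (m := m) x fun _ => 1
  rw [h] at h2
  simpa using h2

/-- Resampling one coordinate does not change the average. -/
lemma erAvg_eq_erAvg_update (i : Fin n) (f : (Fin n → ℕ) → ℝ) :
    erAvg n m f = erAvg n m fun t => erMean m fun k => f (Function.update t i k) := by
  have hsum : ∑ k ∈ Finset.range (m + 1), erWeight m k = 1 := by
    have := sum_erWeight_mul m fun _ => 1
    rw [erMean_const] at this
    simpa using this
  have hW : ∀ (t : Fin n → ℕ) (k : ℕ),
      (∏ j, erWeight m (Function.update t i k j)) * erWeight m (t i) =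
        (∏ j, erWeight m (t j)) * erWeight m k := by
    intro t k
    rw [← Finset.mul_prod_erase _ _ (Finset.mem_univ i),
      ← Finset.mul_prod_erase _ (fun j => erWeight m (t j)) (Finset.mem_univ i)]
    have : ∀ j ∈ Finset.univ.erase i, erWeight m (Function.update t i k j) = erWeight m (t j) :=
      fun j hj => by rw [Function.update_of_ne (Finset.ne_of_mem_erase hj)]
    rw [Finset.prod_congr rfl this, Function.update_self]
    ring
  calc erAvg n m f = ∑ p ∈ scales n m ×ˢ Finset.range (m + 1),
        (∏ j, erWeight m (p.1 j)) * erWeight m p.2 * f p.1 := by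
        rw [Finset.sum_product, erAvg]
        refine Finset.sum_congr rfl fun t _ => ?_
        simp only [mul_right_comm _ _ (f t), ← Finset.mul_sum, hsum, mul_one]
    _ = ∑ p ∈ scales n m ×ˢ Finset.range (m + 1),
        (∏ j, erWeight m (p.1 j)) * erWeight m p.2 * f (Function.update p.1 i p.2) := by
        have hmem : ∀ p ∈ scales n m ×ˢ Finset.range (m + 1),
            (Function.update p.1 i p.2, p.1 i) ∈ scales n m ×ˢ Finset.range (m + 1) := by
          rintro ⟨t, k⟩ hp
          simp only [Finset.mem_product, scales, Fintype.mem_piFinset] at hp ⊢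
          refine ⟨fun j => ?_, hp.1 i⟩
          by_cases hj : j = i
          · rw [hj, Function.update_self]
            exact hp.2
          · rw [Function.update_of_ne hj]
            exact hp.1 j
        -- Exchanging the `i`-th exponent with the fresh sample is a weight-preserving involution.
        refine Finset.sum_nbij' (fun p => (Function.update p.1 i p.2, p.1 i))
          (fun p => (Function.update p.1 i p.2, p.1 i)) hmem hmem ?_ ?_ ?_
        · rintro ⟨t, k⟩ _
          simp
        · rintro ⟨t, k⟩ _
          simp
        · rintro ⟨t, k⟩ _
          simp [hW]
    _ = _ := by
        rw [Finset.sum_product, erAvg]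
        refine Finset.sum_congr rfl fun t _ => ?_
        rw [← sum_erWeight_mul, Finset.mul_sum]
        exact Finset.sum_congr rfl fun k _ => by ring

lemma erAvg_le_of_update (i : Fin n) {f : (Fin n → ℕ) → ℝ} {x : ℝ}
    (h : ∀ t, erMean m (fun k => f (Function.update t i k)) ≤ x) : erAvg n m f ≤ x := by
  rw [erAvg_eq_erAvg_update i]
  exact (erAvg_mono fun t _ => h t).trans_eq (erAvg_const x)

lemma erAvg_two_pow_mul_self (i : Fin n) :
    erAvg n m (fun t => 2 ^ t i * 2 ^ t i) ≤ 3 / 2 * 2 ^ m := by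
  have h := erAvg_prod (m := m) fun (l : Fin n) k => if l = i then (4 : ℝ) ^ k else 1
  have h1 : ∀ l, erMean m (fun k => if l = i then (4 : ℝ) ^ k else 1) =
      if l = i then erMean m (fun k => 4 ^ k) else 1 := fun l => by
    split_ifs
    · rfl
    · exact erMean_const m 1
  simp only [h1, Finset.prod_ite_eq', Finset.mem_univ, if_true] at h
  simp only [← mul_pow]
  norm_num only
  rw [h]
  exact erMean_four_pow_le m

lemma erAvg_two_pow_mul {i j : Fin n} (hij : i ≠ j) :
    erAvg n m (fun t => 2 ^ t i * 2 ^ t j) = ((m : ℝ) / 2 + 1) ^ 2 := by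
  have h := erAvg_prod (m := m) fun (l : Fin n) k =>
    (if l = i then (2 : ℝ) ^ k else 1) * (if l = j then (2 : ℝ) ^ k else 1)
  have h1 : ∀ l, erMean m (fun k => (if l = i then (2 : ℝ) ^ k else 1) *
      (if l = j then (2 : ℝ) ^ k else 1)) =
      (if l = i then (m : ℝ) / 2 + 1 else 1) * (if l = j then (m : ℝ) / 2 + 1 else 1) := by
    intro l
    by_cases hi : l = i
    · have hj : l ≠ j := hi ▸ hij
      simp only [hi, hij, if_true, if_false, mul_one, erMean_two_pow]
    · by_cases hj : l = j
      · simp only [hj, hij.symm, if_true, if_false, one_mul, erMean_two_pow]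
      · simp only [hi, hj, if_false, one_mul, erMean_const]
  simp only [h1, Finset.prod_mul_distrib, Finset.prod_ite_eq', Finset.mem_univ, if_true] at h
  rw [h, sq]

/-- Independence handles the off-diagonal terms. The diagonal ones are heavy, of order `2 ^ m`,
which stays affordable while `2 ^ m ≤ n`. -/
lemma erAvg_sq_sum_two_pow_le (J : Finset (Fin n)) :
    erAvg n m (fun t => (∑ i ∈ J, (2 : ℝ) ^ t i) ^ 2) ≤
      (J.card : ℝ) ^ 2 * ((m : ℝ) / 2 + 1) ^ 2 + J.card * (3 / 2 * 2 ^ m) := by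
  simp only [sq (∑ i ∈ J, _), Finset.sum_mul_sum]
  rw [erAvg_sum]
  simp only [erAvg_sum]
  calc _ ≤ ∑ i ∈ J, ∑ j ∈ J, (((m : ℝ) / 2 + 1) ^ 2 + if i = j then 3 / 2 * 2 ^ m else 0) := by
        refine Finset.sum_le_sum fun i _ => Finset.sum_le_sum fun j _ => ?_
        split_ifs with hij
        · subst hij
          exact (erAvg_two_pow_mul_self i).trans (le_add_of_nonneg_left (sq_nonneg _))
        · rw [erAvg_two_pow_mul hij, add_zero]
    _ = ∑ i ∈ J, ((J.card : ℝ) * ((m : ℝ) / 2 + 1) ^ 2 + 3 / 2 * 2 ^ m) := by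
        refine Finset.sum_congr rfl fun i hi => ?_
        rw [Finset.sum_add_distrib, Finset.sum_ite_eq, if_pos hi]
        simp
    _ = _ := by
        rw [Finset.sum_const, nsmul_eq_mul]
        ring

end Averages

/-! ### Welfare from isolated high values -/

section Isolated

variable {n : ℕ} {𝓕 : Fin n → Set Dist}

/-- The factors of `v i * 1[v i > u] * ∏ j ∈ J, j ≠ i, 1[v j ≤ u]`. -/
def isolatedFactor (J : Finset (Fin n)) (u : ℝ≥0) (i j : Fin n) : ℝ≥0 → ℝ≥0∞ :=
  if j = i then (Set.Ioi u).indicator fun x => (x : ℝ≥0∞)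
  else if j ∈ J then (Set.Iic u).indicator 1 else 1

lemma measurable_isolatedFactor (J : Finset (Fin n)) (u : ℝ≥0) (i j : Fin n) :
    Measurable (isolatedFactor J u i j) := by
  unfold isolatedFactor
  split_ifs
  · exact measurable_coe_nnreal_ennreal.indicator measurableSet_Ioi
  · exact measurable_one.indicator measurableSet_Iic
  · exact measurable_one

/-- At most one summand is nonzero: a coordinate in `J` above `u` kills the products of all other
indices. Buyers outside `J` are unconstrained, since they can only raise the maximum. -/
lemma sum_prod_isolatedFactor_le (J : Finset (Fin n)) (u : ℝ≥0) (v : Fin n → ℝ≥0) :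
    ∑ i ∈ J, ∏ j, isolatedFactor J u i j (v j) ≤ maxVal v := by
  by_cases h : ∃ i₀ ∈ J, u < v i₀
  · obtain ⟨i₀, hi₀, hu⟩ := h
    rw [Finset.sum_eq_single_of_mem i₀ hi₀]
    · rw [← Finset.mul_prod_erase _ _ (Finset.mem_univ i₀)]
      refine (mul_le_of_le_one_right' (Finset.prod_le_one' fun j hj => ?_)).trans ?_
      · rw [isolatedFactor, if_neg (Finset.ne_of_mem_erase hj)]
        split_ifs
        · exact Set.indicator_le_self _ _ _
        · exact le_rfl
      · rw [isolatedFactor, if_pos rfl]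
        exact (Set.indicator_le_self _ _ _).trans (ENNReal.coe_le_coe.2 (le_maxVal v i₀))
    · intro i _ hne
      refine Finset.prod_eq_zero (Finset.mem_univ i₀) ?_
      rw [isolatedFactor, if_neg hne.symm, if_pos hi₀, Set.indicator_of_notMem]
      simpa using hu
  · push Not at h
    rw [Finset.sum_eq_zero]
    · exact zero_le
    · intro i hi
      refine Finset.prod_eq_zero (Finset.mem_univ i) ?_
      rw [isolatedFactor, if_pos rfl, Set.indicator_of_notMem]
      simpa using h i hi

lemma sum_prod_lintegral_isolatedFactor_le_WEL (J : Finset (Fin n)) (u : ℝ≥0) (B : Profile 𝓕) :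
    ∑ i ∈ J, ∏ j, ∫⁻ x, isolatedFactor J u i j x ∂((B j : Dist) : Measure ℝ≥0) ≤ WEL B := by
  calc _ = ∑ i ∈ J, ∫⁻ v, ∏ j, isolatedFactor J u i j (v j) ∂B.law := by
        refine Finset.sum_congr rfl fun i _ => ?_
        have hind : ProbabilityTheory.iIndepFun
            (fun j (v : Fin n → ℝ≥0) => isolatedFactor J u i j (v j)) B.law :=
          ProbabilityTheory.iIndepFun_pi fun j => (measurable_isolatedFactor J u i j).aemeasurable
        rw [ProbabilityTheory.lintegral_prod_eq_prod_lintegral_of_indepFun _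
          (fun j (v : Fin n → ℝ≥0) => isolatedFactor J u i j (v j)) hind
          fun j => (measurable_isolatedFactor J u i j).comp (measurable_pi_apply j)]
        exact Finset.prod_congr rfl fun j _ =>
          (lintegral_eval_law B j (measurable_isolatedFactor J u i j)).symm
    _ = ∫⁻ v, ∑ i ∈ J, ∏ j, isolatedFactor J u i j (v j) ∂B.law := by
        rw [lintegral_finsetSum]
        intro i _
        exact Finset.measurable_prod _ fun j _ =>
          (measurable_isolatedFactor J u i j).comp (measurable_pi_apply j)
    _ ≤ _ := lintegral_mono fun v => sum_prod_isolatedFactor_le J u v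

end Isolated

/-! ### Many buyers: heavy-tailed distributions of unknown scale -/

/-- The part of the mean of `tailDist c (2 ^ k)` above `u`. -/
def upperMean (c : ℝ) (u : ℝ≥0) (k : ℕ) : ℝ :=
  (∫⁻ x, (Set.Ioi u).indicator (fun x : ℝ≥0 => (x : ℝ≥0∞)) x
    ∂(tailDist c (2 ^ k) : Measure ℝ≥0)).toReal

/-- The probability that `tailDist c (2 ^ k)` gives to `[0, u]`. -/
def lowerProb (c : ℝ) (u : ℝ≥0) (k : ℕ) : ℝ :=
  ((tailDist c (2 ^ k) : Measure ℝ≥0) (Set.Iic u)).toReal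

lemma upperMean_nonneg (c : ℝ) (u : ℝ≥0) (k : ℕ) : 0 ≤ upperMean c u k := ENNReal.toReal_nonneg

lemma lowerProb_nonneg (c : ℝ) (u : ℝ≥0) (k : ℕ) : 0 ≤ lowerProb c u k := ENNReal.toReal_nonneg

lemma lowerProb_le_one (c : ℝ) (u : ℝ≥0) (k : ℕ) : lowerProb c u k ≤ 1 :=
  ENNReal.toReal_le_of_le_ofReal zero_le_one (by simpa using prob_le_one)

lemma lintegral_upper_le {c : ℝ} (hc : 0 < c) (u : ℝ≥0) (k : ℕ) :
    ∫⁻ x, (Set.Ioi u).indicator (fun x : ℝ≥0 => (x : ℝ≥0∞)) x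
      ∂(tailDist c (2 ^ k) : Measure ℝ≥0) ≤ ENNReal.ofReal (2 ^ k * (Real.log (1 + c) / c)) := by
  refine (lintegral_mono fun x => Set.indicator_le_self _ _ x).trans
    ((lintegral_tailDist_le hc (2 ^ k)).trans_eq ?_)
  rw [ENNReal.ofReal_mul (by positivity)]
  congr 1
  rw [ENNReal.ofReal_pow (by norm_num)]
  simp

lemma upperMean_le {c : ℝ} (hc : 0 < c) (u : ℝ≥0) (k : ℕ) :
    upperMean c u k ≤ 2 ^ k * (Real.log (1 + c) / c) := by
  have := Real.log_nonneg (show 1 ≤ 1 + c by linarith)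
  exact ENNReal.toReal_le_of_le_ofReal (by positivity) (lintegral_upper_le hc u k)

/-- The logarithm counts the doublings between `2 ^ j` and `2 ^ k`. Of the loss `3`, one comes from
the `1 +` in the survival function and two from `1 ≤ 2 * log 2`. -/
lemma le_upperMean {c : ℝ} (hc : 0 < c) {j k : ℕ} (hk : (2 : ℝ) ^ k ≤ c) :
    2 ^ k * ((k - (j + 3)) * (Real.log 2 / c)) ≤ upperMean c (2 ^ j) k := by
  have hl2 : 1 / 2 ≤ Real.log 2 := by linarith [Real.log_two_gt_d9]
  rcases le_or_gt k j with hkj | hkj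
  · refine le_trans ?_ (upperMean_nonneg _ _ _)
    refine mul_nonpos_of_nonneg_of_nonpos (by positivity)
      (mul_nonpos_of_nonpos_of_nonneg ?_ (by positivity))
    have : (k : ℝ) ≤ j := by exact_mod_cast hkj
    linarith
  obtain ⟨d, rfl⟩ : ∃ d, k = j + 1 + d := ⟨k - (j + 1), by omega⟩
  have hratio : (2 : ℝ) ^ d ≤ (1 + c) / (1 + c / 2 ^ (j + 1 + d) * 2 ^ j) := by
    have h1 : c / 2 ^ (j + 1 + d) * 2 ^ j = c / (2 * 2 ^ d) := by
      rw [pow_add, pow_add]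
      field_simp
    rw [h1, le_div_iff₀ (by positivity)]
    have h2 : (2 : ℝ) ^ d * (1 + c / (2 * 2 ^ d)) = 2 ^ d + c / 2 := by
      field_simp
    have h3 : (2 : ℝ) * 2 ^ d ≤ c := by
      refine le_trans ?_ hk
      rw [← pow_succ']
      exact pow_le_pow_right₀ one_le_two (by omega)
    rw [h2]
    linarith
  have hlog : d * Real.log 2 ≤ Real.log ((1 + c) / (1 + c / 2 ^ (j + 1 + d) * 2 ^ j)) := by
    rw [← Real.log_pow]
    exact Real.log_le_log (by positivity) hratio
  have h := le_lintegral_tailDist_indicator hc (t := 2 ^ (j + 1 + d)) (u := 2 ^ j)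
    (pow_lt_pow_right₀ one_lt_two (by omega))
  have h' := ENNReal.toReal_mono
    (ne_top_of_le_ne_top ENNReal.ofReal_ne_top (lintegral_upper_le hc (2 ^ j) (j + 1 + d))) h
  refine le_trans ?_ h'
  rw [ENNReal.toReal_mul]
  push_cast
  simp only [ENNReal.toReal_pow, ENNReal.toReal_ofNat]
  gcongr
  refine le_trans ?_ ((le_max_left _ 0).trans_eq ENNReal.toReal_ofReal'.symm)
  rw [← mul_div_assoc]
  gcongr
  nlinarith

/-- The form linear in `2 ^ k` is what `erMean_two_pow` can average. -/
lemma le_lowerProb {c : ℝ} (hc : 0 < c) {u : ℝ≥0} (hu : 0 < u) (k : ℕ) :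
    1 + -(1 / (c * u)) * 2 ^ k ≤ lowerProb c u k := by
  have hur : (0 : ℝ) < u := hu
  rw [lowerProb]
  rcases lt_or_ge u (2 ^ k) with h | h
  · rw [tailDist_Iic_of_lt hc h]
    refine le_trans ?_ ((le_max_left _ 0).trans_eq ENNReal.toReal_ofReal'.symm)
    push_cast
    have h1 : 1 / (1 + c / 2 ^ k * (u : ℝ)) ≤ 1 / (c / 2 ^ k * u) :=
      one_div_le_one_div_of_le (by positivity) (by linarith)
    have h2 : 1 / (c / 2 ^ k * (u : ℝ)) = 1 / (c * u) * 2 ^ k := by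
      field_simp
    linarith
  · rw [tailDist_Iic_of_le h, ENNReal.toReal_one]
    have : 0 ≤ 1 / (c * (u : ℝ)) * 2 ^ k := by positivity
    linarith

lemma erMean_two_pow_mul_sub (m : ℕ) (a : ℝ) :
    erMean m (fun k => 2 ^ k * (k - a)) = m ^ 2 / 4 + 3 * m / 4 - a * m / 2 - a := by
  induction m with
  | zero => simp [erMean_zero]
  | succ m ih =>
    rw [erMean_succ, ih, pow_succ]
    push_cast
    field_simp
    ring

section ManyBuyers

variable {n : ℕ}

/-- Buyers `0` and `1` have point masses at `s`, buyer `i ≥ 2` has a heavy-tailed distribution of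
scale `2 ^ t i`. -/
def guardedProfile (hn : 0 < n) (s : ℝ≥0) (t : Fin n → ℕ) :
    Profile (fun _ : Fin n => regularDists) := fun i =>
  if 2 ≤ (i : ℕ) then
    ⟨tailDist n (2 ^ t i), isRegular_tailDist (by exact_mod_cast hn) (by positivity)⟩
  else ⟨pointDist s, isRegular_pointDist s⟩

/-- The buyers with heavy-tailed distributions. -/
def tailBuyers (n : ℕ) : Finset (Fin n) := Finset.univ.filter fun i => 2 ≤ (i : ℕ)

lemma mem_tailBuyers {i : Fin n} : i ∈ tailBuyers n ↔ 2 ≤ (i : ℕ) := by simp [tailBuyers]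

lemma card_compl_tailBuyers (hn : 2 ≤ n) : (tailBuyers n)ᶜ.card = 2 := by
  have : (tailBuyers n)ᶜ = {⟨0, by omega⟩, ⟨1, by omega⟩} := by
    ext i
    simp only [Finset.mem_compl, mem_tailBuyers, Finset.mem_insert, Finset.mem_singleton,
      Fin.ext_iff]
    omega
  rw [this, Finset.card_pair (by simp)]

lemma card_tailBuyers (hn : 2 ≤ n) : ((tailBuyers n).card : ℝ) = n - 2 := by
  have h := Finset.card_add_card_compl (tailBuyers n)
  rw [card_compl_tailBuyers hn, Fintype.card_fin] at h
  rw [eq_sub_iff_add_eq]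
  exact_mod_cast h

lemma guardedProfile_of_mem (hn : 0 < n) (s : ℝ≥0) (t : Fin n → ℕ) {i : Fin n}
    (hi : i ∈ tailBuyers n) : (guardedProfile hn s t i : Dist) = tailDist n (2 ^ t i) := by
  rw [guardedProfile, if_pos (mem_tailBuyers.1 hi)]

lemma guardedProfile_of_notMem (hn : 0 < n) (s : ℝ≥0) (t : Fin n → ℕ) {i : Fin n}
    (hi : i ∉ tailBuyers n) : (guardedProfile hn s t i : Dist) = pointDist s := by
  rw [guardedProfile, if_neg (mt mem_tailBuyers.2 hi)]

lemma guardedProfile_update (hn : 0 < n) (s : ℝ≥0) (t : Fin n → ℕ) {i : Fin n}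
    (hi : i ∈ tailBuyers n) (k : ℕ) :
    guardedProfile hn s (Function.update t i k) = Function.update (guardedProfile hn s t) i
      ⟨tailDist n (2 ^ k), isRegular_tailDist (by exact_mod_cast hn) (by positivity)⟩ := by
  funext j
  by_cases hj : j = i
  · subst hj
    rw [Function.update_self]
    exact Subtype.ext (by rw [guardedProfile_of_mem hn s _ hi, Function.update_self])
  · rw [Function.update_of_ne hj]
    refine Subtype.ext ?_
    by_cases hjJ : j ∈ tailBuyers n
    · rw [guardedProfile_of_mem hn s _ hjJ, guardedProfile_of_mem hn s _ hjJ,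
        Function.update_of_ne hj]
    · rw [guardedProfile_of_notMem hn s _ hjJ, guardedProfile_of_notMem hn s _ hjJ]

lemma WEL_guardedProfile_lt_top (hn : 0 < n) (s : ℝ≥0) (t : Fin n → ℕ) :
    WEL (guardedProfile hn s t) < ⊤ := by
  refine (WEL_le_sum _).trans_lt (ENNReal.sum_lt_top.2 fun i _ => ?_)
  by_cases hi : i ∈ tailBuyers n
  · rw [guardedProfile_of_mem hn s t hi]
    exact (lintegral_tailDist_le (by exact_mod_cast hn) _).trans_lt
      (ENNReal.mul_lt_top ENNReal.coe_lt_top ENNReal.ofReal_lt_top)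
  · rw [guardedProfile_of_notMem hn s t hi, lintegral_pointDist]
    exact ENNReal.coe_lt_top

lemma le_SPA_guardedProfile (hn : 2 ≤ n) (s : ℝ≥0) (t : Fin n → ℕ) :
    (s : ℝ≥0∞) ≤ SPA (guardedProfile (by omega) s t) := by
  have h : ∀ i : Fin n, (i : ℕ) < 2 → i ∉ tailBuyers n := fun i hi => by
    rw [mem_tailBuyers]
    omega
  exact le_SPA _ (i := ⟨0, by omega⟩) (j := ⟨1, by omega⟩) (by simp)
    (guardedProfile_of_notMem _ s t (h _ (by simp)))
    (guardedProfile_of_notMem _ s t (h _ (by simp))) le_rfl le_rfl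

/-- Each guard pays at most `s` by individual rationality. For a tail buyer, resampling only that
buyer's scale reduces to the one-buyer bound. -/
lemma erAvg_rev_guardedProfile_le (hn : 2 ≤ n) (M : Mechanism (fun _ : Fin n => regularDists))
    (hM : M.Valid) (s : ℝ≥0) (m : ℕ) :
    erAvg n m (fun t => M.rev (guardedProfile (by omega) s t)) ≤
      2 * s + Real.log (1 + n) := by
  have hn0 : (0 : ℝ) < n := by exact_mod_cast (by omega)
  have hlog : 0 ≤ Real.log (1 + n) := Real.log_nonneg (by linarith)
  have htail : ∀ i ∈ tailBuyers n,
      erAvg n m (fun t => M.pay i (guardedProfile (by omega) s t)) ≤ Real.log (1 + n) / n := by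
    intro i hi
    refine erAvg_le_of_update i fun t => ?_
    simp only [guardedProfile_update _ s t hi]
    refine M.erMean_pay_le hM i _
      (fun k => ⟨tailDist n (2 ^ k), isRegular_tailDist hn0 (by positivity)⟩)
      (v := tailQuantile n) (fun k => ?_) (by positivity) ?_ m
    -- The point `q = 0` is left out: there `1 / q = 0` makes `tailQuantile` vanish.
    · rw [← restrict_Ioc_eq_restrict_Icc]
      exact (ae_restrict_iff' measurableSet_Ioc).2 (Filter.Eventually.of_forall fun q hq =>
        quantile_tailDist hn0 hq.1)
    · rw [← restrict_Ioc_eq_restrict_Icc]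
      exact lintegral_tailQuantile_le hn0
  have hguard : ∀ i ∈ (tailBuyers n)ᶜ,
      erAvg n m (fun t => M.pay i (guardedProfile (by omega) s t)) ≤ s := by
    intro i hi
    refine (erAvg_mono fun t _ => ?_).trans_eq (erAvg_const _)
    exact M.pay_le_of_pointDist hM i _ (guardedProfile_of_notMem _ s t (Finset.mem_compl.1 hi))
  simp only [Mechanism.rev]
  rw [erAvg_sum, ← Finset.sum_compl_add_sum (tailBuyers n)]
  refine add_le_add ((Finset.sum_le_sum hguard).trans_eq ?_)
    ((Finset.sum_le_sum htail).trans ?_)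
  · simp [card_compl_tailBuyers hn]
  · rw [Finset.sum_const, nsmul_eq_mul, card_tailBuyers hn, ← mul_div_assoc, div_le_iff₀ hn0]
    nlinarith

/-- The real factors of the contribution of isolated high values to the welfare. -/
def isolatedMean (n : ℕ) (u : ℝ≥0) (i j : Fin n) (k : ℕ) : ℝ :=
  if j = i then upperMean n u k else if j ∈ tailBuyers n then lowerProb n u k else 1

lemma isolatedMean_nonneg (u : ℝ≥0) (i j : Fin n) (k : ℕ) : 0 ≤ isolatedMean n u i j k := by
  unfold isolatedMean
  split_ifs
  exacts [upperMean_nonneg _ _ _, lowerProb_nonneg _ _ _, zero_le_one]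

lemma sum_prod_isolatedMean_le_WEL (hn : 0 < n) (s u : ℝ≥0) (t : Fin n → ℕ) :
    ∑ i ∈ tailBuyers n, ∏ j, isolatedMean n u i j (t j) ≤
      (WEL (guardedProfile hn s t)).toReal := by
  have h := sum_prod_lintegral_isolatedFactor_le_WEL (tailBuyers n) u (guardedProfile hn s t)
  have htop := (WEL_guardedProfile_lt_top hn s t).ne
  refine le_trans (le_of_eq ?_) (ENNReal.toReal_mono htop h)
  rw [ENNReal.toReal_sum fun i hi =>
    ne_top_of_le_ne_top htop ((Finset.single_le_sum_of_canonicallyOrdered hi).trans h)]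
  refine Finset.sum_congr rfl fun i hi => ?_
  rw [ENNReal.toReal_prod]
  refine Finset.prod_congr rfl fun j _ => ?_
  unfold isolatedMean isolatedFactor
  split_ifs with h1 h2
  · rw [h1, guardedProfile_of_mem hn s t hi, upperMean]
  · rw [guardedProfile_of_mem hn s t h2, lowerProb, lintegral_indicator_one measurableSet_Iic]
  · simp

/-- Used squared: it reduces the second moment of the isolated welfare to that of a sum of scales.
-/
lemma sum_prod_isolatedMean_le (hn : 0 < n) (u : ℝ≥0) (t : Fin n → ℕ) :
    ∑ i ∈ tailBuyers n, ∏ j, isolatedMean n u i j (t j) ≤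
      Real.log (1 + n) / n * ∑ i ∈ tailBuyers n, (2 : ℝ) ^ t i := by
  rw [Finset.mul_sum]
  refine Finset.sum_le_sum fun i _ => ?_
  rw [← Finset.mul_prod_erase _ _ (Finset.mem_univ i), mul_comm (Real.log _ / _)]
  refine (mul_le_of_le_one_right (isolatedMean_nonneg _ _ _ _) (Finset.prod_le_one
    (fun j _ => isolatedMean_nonneg _ _ _ _) fun j hj => ?_)).trans ?_
  · rw [isolatedMean, if_neg (Finset.ne_of_mem_erase hj)]
    split_ifs
    exacts [lowerProb_le_one _ _ _, le_rfl]
  · rw [isolatedMean, if_pos rfl]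
    exact upperMean_le (by exact_mod_cast hn) u (t i)

/-- Independence splits the average into one upper mean and the probabilities that the other tail
buyers stay below `2 ^ j`. The condition on `j` makes each miss probability at most `1 / (2 n)` on
average, so isolation costs at most a factor `2`. -/
lemma le_erAvg_sum_prod_isolatedMean (hn : 2 ≤ n) {m j : ℕ} (hmn : (2 : ℝ) ^ m ≤ n)
    (hj : (m : ℝ) + 2 ≤ 2 ^ j) :
    (n - 2) * (Real.log 2 / n * (m ^ 2 / 4 + 3 * m / 4 - (j + 3) * m / 2 - (j + 3))) / 2 ≤
      erAvg n m (fun t => ∑ i ∈ tailBuyers n, ∏ l, isolatedMean n (2 ^ j) i l (t l)) := by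
  have hn0 : (0 : ℝ) < n := by exact_mod_cast (by omega)
  have hn2 : (2 : ℝ) ≤ n := by exact_mod_cast hn
  have hl2 : 0 < Real.log 2 := Real.log_pos one_lt_two
  have hm0 : (0 : ℝ) ≤ m := m.cast_nonneg
  have hupper : Real.log 2 / n * (m ^ 2 / 4 + 3 * m / 4 - (j + 3) * m / 2 - (j + 3)) ≤
      erMean m (upperMean n (2 ^ j)) := by
    rw [← erMean_two_pow_mul_sub, ← erMean_mul]
    refine erMean_mono fun k hk => ?_
    refine le_trans (le_of_eq ?_)
      (le_upperMean hn0 ((pow_le_pow_right₀ one_le_two hk).trans hmn))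
    ring
  have hupper0 : 0 ≤ erMean m (upperMean n (2 ^ j)) := by
    rw [← erMean_const m 0]
    exact erMean_mono fun k _ => upperMean_nonneg _ _ _
  have hlower0 : 0 ≤ erMean m (lowerProb n (2 ^ j)) := by
    rw [← erMean_const m 0]
    exact erMean_mono fun k _ => lowerProb_nonneg _ _ _
  have hlower1 : erMean m (lowerProb n (2 ^ j)) ≤ 1 := by
    rw [← erMean_const m 1]
    exact erMean_mono fun k _ => lowerProb_le_one _ _ _
  have hlower : 1 - 1 / (2 * n) ≤ erMean m (lowerProb n (2 ^ j)) := by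
    have h1 : erMean m (fun k => 1 + -(1 / (n * (2 : ℝ) ^ j)) * 2 ^ k) ≤
        erMean m (lowerProb n (2 ^ j)) := by
      refine erMean_mono fun k _ => ?_
      have := le_lowerProb hn0 (u := 2 ^ j) (by positivity) k
      push_cast at this
      exact this
    rw [erMean_add, erMean_const, erMean_mul, erMean_two_pow] at h1
    refine le_trans ?_ h1
    have h2 : 1 / (n * (2 : ℝ) ^ j) * ((m : ℝ) / 2 + 1) ≤ 1 / (2 * n) := by
      rw [div_mul_eq_mul_div, one_mul, div_le_div_iff₀ (by positivity) (by positivity)]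
      nlinarith
    linarith
  have hterm : ∀ i ∈ tailBuyers n, erMean m (upperMean n (2 ^ j)) / 2 ≤
      erAvg n m (fun t => ∏ l, isolatedMean n (2 ^ j) i l (t l)) := by
    intro i _
    rw [erAvg_prod, ← Finset.mul_prod_erase _ _ (Finset.mem_univ i)]
    have h1 : erMean m (isolatedMean n (2 ^ j) i i) = erMean m (upperMean n (2 ^ j)) := by
      congr 1
      funext k
      rw [isolatedMean, if_pos rfl]
    rw [h1, div_eq_mul_inv]
    refine mul_le_mul_of_nonneg_left ?_ hupper0
    calc (2 : ℝ)⁻¹ ≤ erMean m (lowerProb n (2 ^ j)) ^ (Finset.univ.erase i).card := by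
          rw [Finset.card_erase_of_mem (Finset.mem_univ i), Finset.card_univ, Fintype.card_fin]
          -- Bernoulli's inequality: `(1 - 1 / (2 n)) ^ (n - 1) ≥ 1 / 2`.
          have h2 := one_add_mul_le_pow (a := erMean m (lowerProb n (2 ^ j)) - 1)
            (by linarith) (n - 1)
          rw [add_sub_cancel] at h2
          refine le_trans ?_ h2
          have h3 : ((n - 1 : ℕ) : ℝ) ≤ n := by exact_mod_cast Nat.sub_le n 1
          have h4 : (n : ℝ) * (1 / (2 * n)) = 1 / 2 := by field_simp
          have h5 : (0 : ℝ) ≤ ((n - 1 : ℕ) : ℝ) := Nat.cast_nonneg _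
          nlinarith
      _ ≤ _ := by
          rw [← Finset.prod_const]
          refine Finset.prod_le_prod (fun _ _ => hlower0) fun l hl => ?_
          have hli := Finset.ne_of_mem_erase hl
          by_cases hlJ : l ∈ tailBuyers n
          · refine erMean_mono fun k _ => ?_
            rw [isolatedMean, if_neg hli, if_pos hlJ]
          · refine hlower1.trans ?_
            rw [← erMean_const m 1]
            refine erMean_mono fun k _ => ?_
            rw [isolatedMean, if_neg hli, if_neg hlJ]
  rw [erAvg_sum]
  refine le_trans ?_ (Finset.sum_le_sum hterm)
  rw [Finset.sum_const, nsmul_eq_mul, card_tailBuyers hn, mul_div_assoc]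
  gcongr

end ManyBuyers

/-! ### Truncation and numerical estimates -/

lemma sub_sq_div_le_min {x C : ℝ} (hC : 0 < C) : x - x ^ 2 / (4 * C) ≤ min x C := by
  refine le_min (sub_le_self _ (by positivity)) ?_
  have : C - (x - x ^ 2 / (4 * C)) = (x - 2 * C) ^ 2 / (4 * C) := by
    field_simp
    ring
  have h2 : 0 ≤ (x - 2 * C) ^ 2 / (4 * C) := by positivity
  linarith

lemma add_two_le_two_pow_div_eight {m : ℕ} (hm : 56 ≤ m) : m + 2 ≤ 2 ^ (m / 8) := by
  have h : ∀ j, 7 ≤ j → 8 * j + 9 ≤ 2 ^ j := by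
    intro j hj
    induction j, hj using Nat.le_induction with
    | base => norm_num
    | succ j hj ih =>
      rw [pow_succ]
      omega
  have := h (m / 8) (by omega)
  omega

/-- With threshold exponent at most `m / 8` the leading term is at least `(1/4 - 1/16) * m ^ 2 =
0.1875 * m ^ 2`; the margin over `0.185` pays for lower-order terms and for rounding `l` down. -/
lemma le_exponent_gain {m : ℕ} (hm : 2752 ≤ m) {l : ℝ} (hl : 0 ≤ l) (hlm : l < m + 1) :
    0.185 * l ^ 2 ≤ (m : ℝ) ^ 2 / 4 + 3 * m / 4 - ((m / 8 : ℕ) + 3) * m / 2 -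
      ((m / 8 : ℕ) + 3) := by
  have hm0 : (2752 : ℝ) ≤ m := by exact_mod_cast hm
  have hj : ((m / 8 : ℕ) : ℝ) ≤ m / 8 := by exact_mod_cast Nat.cast_div_le (α := ℝ)
  have h1 : (((m / 8 : ℕ) : ℝ) + 3) * m ≤ (m / 8 + 3) * m := by gcongr
  have h2 : l ^ 2 ≤ ((m : ℝ) + 1) ^ 2 := pow_le_pow_left₀ hl hlm.le 2
  have h3 : 2752 * (m : ℝ) ≤ (m : ℝ) ^ 2 := by nlinarith
  linarith

lemma le_weighted_exponent_gain {n m : ℕ} (hn : (2752 : ℝ) ≤ n) (hm : 2752 ≤ m) {l : ℝ}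
    (hl : 0 ≤ l) (hlm : l < m + 1) :
    0.09 * (Real.log 2 * l ^ 2) ≤ (n - 2) * (Real.log 2 / n * ((m : ℝ) ^ 2 / 4 + 3 * m / 4 -
      ((m / 8 : ℕ) + 3) * m / 2 - ((m / 8 : ℕ) + 3))) / 2 := by
  have hl2 : 0 < Real.log 2 := Real.log_pos one_lt_two
  have hn0 : (0 : ℝ) < n := by linarith
  have hgain := le_exponent_gain hm hl hlm
  generalize (m : ℝ) ^ 2 / 4 + 3 * m / 4 - ((m / 8 : ℕ) + 3) * m / 2 - ((m / 8 : ℕ) + 3) = x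
    at hgain ⊢
  have hfrac : 0.99 ≤ ((n : ℝ) - 2) / n := by
    rw [le_div_iff₀ hn0]
    linarith
  have h0 : 0 ≤ Real.log 2 * l ^ 2 := by positivity
  calc _ ≤ 0.99 * (Real.log 2 * (0.185 * l ^ 2)) / 2 := by linarith
    _ ≤ ((n : ℝ) - 2) / n * (Real.log 2 * x) / 2 := by gcongr
    _ = _ := by ring

lemma exists_instance_of_lt_logb (n : ℕ) (hn : 2 ≤ n) (K : ℝ) (hK : 8 ≤ K)
    (M : Mechanism (fun _ : Fin n => regularDists)) (hM : M.Valid)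
    (hlog : 344 * K < Real.logb 2 n) :
    ∃ F : Profile (fun _ : Fin n => regularDists), 0 < SPA F ∧ WEL F < ⊤ ∧
      M.rev F ≤ min (1382.4 / (K + Real.logb 2 n) * (WEL F).toReal)
        ((2 : ℝ) ^ K * (SPA F).toReal) := by
  set l := Real.logb 2 n with hl
  have hn0 : (0 : ℝ) < n := by exact_mod_cast (by omega)
  have hl2 : 0 < Real.log 2 := Real.log_pos one_lt_two
  have hpow : (2 : ℝ) ^ l = n := Real.rpow_logb two_pos (by norm_num) hn0
  have hlpos : 2752 < l := by linarith
  set h := Real.log (1 + n) with hh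
  have hhpos : 0 < h := Real.log_pos (by linarith)
  have hhle : h ≤ (l + 1) * Real.log 2 := by
    have h1 : h ≤ Real.log (2 * n) := Real.log_le_log (by linarith) (by
      have : (1 : ℝ) ≤ n := by exact_mod_cast (by omega)
      linarith)
    rw [Real.log_mul two_ne_zero hn0.ne', ← hpow, Real.log_rpow two_pos] at h1
    linarith
  -- The largest exponent with `2 ^ m ≤ n`, as both the tail estimate and the diagonal second
  -- moments need.
  set m := ⌊l⌋₊ with hm
  have hml : (m : ℝ) ≤ l := Nat.floor_le (by linarith)
  have hlm : l < m + 1 := Nat.lt_floor_add_one l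
  have hm2 : 2752 ≤ m := Nat.le_floor (by exact_mod_cast hlpos.le)
  have hmn : (2 : ℝ) ^ m ≤ n := by
    rw [← hpow, ← Real.rpow_natCast]
    exact Real.rpow_le_rpow_of_exponent_le one_le_two hml
  have hnbig : (2752 : ℝ) ≤ n := by
    refine le_trans ?_ hmn
    have h1 : m < 2 ^ m := Nat.lt_two_pow_self
    have h2 : (2752 : ℕ) ≤ 2 ^ m := by omega
    exact_mod_cast h2
  have hj : (m : ℝ) + 2 ≤ 2 ^ (m / 8) := by
    exact_mod_cast add_two_le_two_pow_div_eight (by omega)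
  set L := (K + l) / 1382.4 with hL
  have hL' : L = (K + l) * (5 / 6912) := by
    rw [hL]
    norm_num
    ring
  have hLlow : l * (5 / 6912) ≤ L := by linarith
  have hLhigh : L ≤ 345 / 344 * l * (5 / 6912) := by linarith
  have hLpos : 0 < L := lt_of_lt_of_le (by positivity) hLlow
  -- The guards cost `24 * h` in the revenue bound and give `2 ^ K * SPA ≥ 256 * 12 * h = 3072 * h`,
  -- which is where the truncation level `C` below comes from.
  set s : ℝ≥0 := ⟨12 * h, by positivity⟩ with hs
  have hsr : (s : ℝ) = 12 * h := rfl
  set P := guardedProfile (n := n) (by omega) s with hP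
  set W : (Fin n → ℕ) → ℝ := fun t =>
    ∑ i ∈ tailBuyers n, ∏ j, isolatedMean n (2 ^ (m / 8)) i j (t j) with hW
  set S : (Fin n → ℕ) → ℝ := fun t => (∑ i ∈ tailBuyers n, (2 : ℝ) ^ t i) ^ 2 with hS
  have hWnonneg : ∀ t, 0 ≤ W t := fun t =>
    Finset.sum_nonneg fun i _ => Finset.prod_nonneg fun j _ => isolatedMean_nonneg _ _ _ _
  set C := 3072 * h * L with hC
  have hCpos : 0 < C := by positivity
  by_contra! hcon
  have hrev : ∀ t ∈ scales n m,
      1 / L * (W t - (h / n) ^ 2 / (4 * C) * S t) ≤ M.rev (P t) := by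
    intro t _
    have hSPA := le_SPA_guardedProfile hn s t
    have hWtop := WEL_guardedProfile_lt_top (n := n) (by omega) s t
    have hspos : (0 : ℝ≥0∞) < s := ENNReal.coe_pos.2 (NNReal.coe_pos.1 (by rw [hsr]; positivity))
    refine le_trans ?_ (hcon (P t) (hspos.trans_le hSPA) hWtop).le
    have hSPA' : 12 * h ≤ (SPA (P t)).toReal := by
      have := ENNReal.toReal_mono ((SPA_le_WEL (P t)).trans_lt hWtop).ne hSPA
      rwa [ENNReal.coe_toReal, hsr] at this
    have hK2 : (256 : ℝ) ≤ (2 : ℝ) ^ K := by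
      calc (256 : ℝ) = (2 : ℝ) ^ (8 : ℝ) := by norm_num
        _ ≤ _ := Real.rpow_le_rpow_of_exponent_le one_le_two hK
    have h1 : W t - (h / n) ^ 2 / (4 * C) * S t ≤ min (W t) C := by
      refine le_trans ?_ (sub_sq_div_le_min hCpos)
      have h2 : W t ^ 2 ≤ (h / n) ^ 2 * S t := by
        rw [hS, ← mul_pow]
        exact pow_le_pow_left₀ (hWnonneg t) (sum_prod_isolatedMean_le (by omega) _ t) 2
      have h3 : W t ^ 2 / (4 * C) ≤ (h / n) ^ 2 * S t / (4 * C) := by gcongr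
      rw [div_mul_eq_mul_div]
      linarith
    have h4 : 1382.4 / (K + l) = 1 / L := by rw [hL, one_div_div]
    rw [h4]
    refine le_min ?_ ?_
    · gcongr
      exact (h1.trans (min_le_left _ _)).trans (sum_prod_isolatedMean_le_WEL (by omega) s _ t)
    · calc _ ≤ 1 / L * C := by
            gcongr
            exact h1.trans (min_le_right _ _)
        _ = 256 * (12 * h) := by
            rw [hC]
            field_simp
            norm_num
        _ ≤ _ := by gcongr
  have havg := (erAvg_mono hrev).trans (erAvg_rev_guardedProfile_le hn M hM s m)
  rw [erAvg_mul, erAvg_sub, erAvg_mul, hsr, ← hh, one_div_mul_eq_div, div_le_iff₀ hLpos] at havg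
  have hWavg := le_erAvg_sum_prod_isolatedMean hn hmn hj
  have hSavg := erAvg_sq_sum_two_pow_le (m := m) (tailBuyers n)
  rw [card_tailBuyers hn] at hSavg
  have hn2 : (0 : ℝ) ≤ n - 2 := by linarith
  have hSavg' : erAvg n m S ≤ n ^ 2 * (0.2511 * l ^ 2) := by
    refine hSavg.trans ?_
    have h1 : ((n : ℝ) - 2) ^ 2 ≤ n ^ 2 := pow_le_pow_left₀ hn2 (by linarith) 2
    have h2 : ((n : ℝ) - 2) * (3 / 2 * 2 ^ m) ≤ n * (3 / 2 * n) := by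
      gcongr
      linarith
    have h3 : ((m : ℝ) / 2 + 1) ^ 2 + 3 / 2 ≤ 0.2511 * l ^ 2 := by
      have : ((m : ℝ) / 2 + 1) ^ 2 ≤ (l / 2 + 1) ^ 2 := by gcongr
      nlinarith
    calc _ ≤ (n : ℝ) ^ 2 * ((m : ℝ) / 2 + 1) ^ 2 + n * (3 / 2 * n) := by gcongr
      _ = (n : ℝ) ^ 2 * (((m : ℝ) / 2 + 1) ^ 2 + 3 / 2) := by ring
      _ ≤ _ := by gcongr
  have hloss : (h / n) ^ 2 / (4 * C) * erAvg n m S ≤ 0.0283 * (h * l) := by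
    calc _ ≤ (h / n) ^ 2 / (4 * C) * (n ^ 2 * (0.2511 * l ^ 2)) := by gcongr
      _ = h * (0.2511 * l ^ 2) / (12288 * L) := by
          rw [hC]
          field_simp
          norm_num
      _ ≤ _ := by
          rw [div_le_iff₀ (by positivity)]
          have h1 : 0.2511 * l ^ 2 ≤ 0.0283 * l * (12288 * L) := by
            have h2 := mul_le_mul_of_nonneg_left hLlow (show 0 ≤ l by linarith)
            have h3 : l * (l * (5 / 6912)) = l ^ 2 * (5 / 6912) := by ring
            have h4 : 0 ≤ l ^ 2 := sq_nonneg l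
            linarith
          calc _ ≤ h * (0.0283 * l * (12288 * L)) := by gcongr
            _ = _ := by ring
  have hmain : 0.09 * (Real.log 2 * l ^ 2) ≤ erAvg n m W :=
    (le_weighted_exponent_gain hnbig hm2 (by linarith) hlm).trans hWavg
  have hbudget : (2 * (12 * h) + h) * L ≤ 0.0182 * (h * l) := by
    have h1 : 25 * L ≤ 0.0182 * l := by linarith
    calc _ = h * (25 * L) := by ring
      _ ≤ h * (0.0182 * l) := by gcongr
      _ = _ := by ring
  have hhl : h * l ≤ 1.001 * (Real.log 2 * l ^ 2) := by
    calc h * l ≤ (l + 1) * Real.log 2 * l := by gcongr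
      _ ≤ 1.001 * l * Real.log 2 * l := by
          gcongr
          linarith
      _ = _ := by ring
  -- Final balance in units of `log 2 * l ^ 2`: the gain `0.09` exceeds `1.001 * (0.0283 + 0.0182)`,
  -- truncation loss plus revenue budget.
  have hfin : 0 < Real.log 2 * l ^ 2 := by positivity
  linarith

end DistReport

end

theorem mainTheorem4 (n : ℕ) (hn : 2 ≤ n) (K : ℝ) (hK : 8 ≤ K)
    (M : DistReport.Mechanism (fun _ : Fin n => DistReport.regularDists)) (hM : M.Valid) :
    ∃ F : DistReport.Profile (fun _ : Fin n => DistReport.regularDists),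
      0 < DistReport.SPA F ∧ DistReport.WEL F < ⊤ ∧
      M.rev F ≤
        min (1382.4 / (K + Real.logb 2 n) * (DistReport.WEL F).toReal)
          ((2 : ℝ) ^ K * (DistReport.SPA F).toReal) := by
  rcases le_or_gt (Real.logb 2 n) (344 * K) with h | h
  · exact DistReport.exists_instance_of_logb_le n hn K hK M hM h
  · exact DistReport.exists_instance_of_lt_logb n hn K hK M hM h
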